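/- Let $A(\rho)=A_0+\sum_{i=1}^p\rho_iA_i$ with $A_0,\dots,A_p\in\mathbb{R}^{n\times n}$, let $B\in\mathbb{R}^{n\times m}$, and let $\mathcal{P}\subset\mathbb{R}^p$ be a nonempty convex compact polytope. Let $R\succ0$ and $Q\succeq0$ be real symmetric matrices of sizes $m\times m$ and $n\times n$, and suppose that for every $\rho\in\mathcal{P}$ the pair $(A(\rho),B)$ is stabilizable and the pair $(A(\rho),\sqrt{Q})$ is detectable. Call $K\in\mathbb{R}^{m\times n}$ an optimal LQR gain at $\rho$ if for every $x_0\in\mathbb{R}^n$ the feedback $u=-Kx$ attains the minimum of $\int_0^\infty \big(u^\top Ru+x^\top Qx\big)\,dt$ over all $(x,u)$ with $u$ locally integrable on $[0,\infty)$ and $\dot x=A(\rho)x+Bu$, $x(0)=x_0$. Then for every $\rho\in\mathcal{P}$ there is exactly one optimal LQR gain $K^*_\rho$. Put $\mathcal{K}^*=\{K^*_\rho:\rho\in\mathcal{P}\}$. (i) For every $i=1,\dots,mn$ the minimum $\underline K_i$ and the maximum $\overline K_i$ of the $i$-th entry $K_i$ of $\operatorname{vec}(K)$ over all $(K,P,\rho)$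 subject to $$A(\rho)^\top P+PA(\rho)-PBR^{-1}B^\top P+Q=0,\qquad K=R^{-1}B^\top P,\qquad \rho\in\mathcal{P},\qquad P\succeq0$$ exist (are attained), and $\operatorname{vec}(\mathcal{K}^*)\subseteq\mathcal{C}:=\prod_{i=1}^{mn}[\underline K_i,\overline K_i]$. (ii) If, in addition, $(A(\rho),\sqrt{Q})$ is observable for every $\rho\in\mathcal{P}$, then the same holds with the constraint $P\succeq0$ replaced by $P\succ0$: the minimum $\underline K_i$ and the maximum $\overline K_i$ of each $K_i$ over the feasible $(K,P,\rho)$ with $P\succ0$ exist, and $\operatorname{vec}(\mathcal{K}^*)\subseteq\prod_{i=1}^{mn}[\underline K_i,\overline K_i]$. -/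

import Mathlib

open Set Matrix MeasureTheory
open scoped MatrixOrder

noncomputable section

/-- A real square matrix is Hurwitz if all its complex eigenvalues have negative real part. -/
def IsHurwitz {n : ℕ} (M : Matrix (Fin n) (Fin n) ℝ) : Prop :=
  ∀ z ∈ spectrum ℂ (M.map (algebraMap ℝ ℂ)), z.re < 0

/-- The pair `(A, B)` is stabilizable: some state feedback `u = -F x` makes it Hurwitz. -/
def IsStabilizable {n m : ℕ} (A : Matrix (Fin n) (Fin n) ℝ) (B : Matrix (Fin n) (Fin m) ℝ) :
    Prop :=
  ∃ F : Matrix (Fin m) (Fin n) ℝ, IsHurwitz (A - B * F)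

/-- The pair `(A, C)` is detectable: some output injection makes it Hurwitz. -/
def IsDetectable {n q : ℕ} (A : Matrix (Fin n) (Fin n) ℝ) (C : Matrix (Fin q) (Fin n) ℝ) :
    Prop :=
  ∃ L : Matrix (Fin n) (Fin q) ℝ, IsHurwitz (A - L * C)

/-- The pair `(A, C)` is observable: the unobservable subspace `⋂ k, ker (C * A ^ k)` is zero. -/
def IsObservable {n q : ℕ} (A : Matrix (Fin n) (Fin n) ℝ) (C : Matrix (Fin q) (Fin n) ℝ) :
    Prop :=
  ∀ x : Fin n → ℝ, (∀ k : ℕ, (C * A ^ k) *ᵥ x = 0) → x = 0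

/-- The positive semidefinite square root of a positive semidefinite matrix. -/
def matSqrt {n : ℕ} (Q : Matrix (Fin n) (Fin n) ℝ) : Matrix (Fin n) (Fin n) ℝ :=
  CFC.sqrt Q

/-- A (convex, compact) polytope: the convex hull of finitely many points. -/
def IsPolytope {p : ℕ} (S : Set (Fin p → ℝ)) : Prop :=
  ∃ V : Set (Fin p → ℝ), V.Finite ∧ S = convexHull ℝ V

/-- The affine parameter-dependent system matrix `A(ρ) = A₀ + ∑ i, ρ i • A i`. -/
def lpvMatrix {n p : ℕ} (A₀ : Matrix (Fin n) (Fin n) ℝ)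
    (A : Fin p → Matrix (Fin n) (Fin n) ℝ) (ρ : Fin p → ℝ) : Matrix (Fin n) (Fin n) ℝ :=
  A₀ + ∑ i, ρ i • A i

/-- `(x, u)` is a (Carathéodory) trajectory of `x' = A x + B u`, `x 0 = x₀` on `[0, ∞)`, with a
locally integrable input `u`. -/
structure IsTrajectory {n m : ℕ} (A : Matrix (Fin n) (Fin n) ℝ) (B : Matrix (Fin n) (Fin m) ℝ)
    (x₀ : Fin n → ℝ) (x : ℝ → Fin n → ℝ) (u : ℝ → Fin m → ℝ) : Prop where
  continuousOn : ContinuousOn x (Ici 0)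
  locallyIntegrable : ∀ T : ℝ, 0 ≤ T → IntervalIntegrable u volume 0 T
  integral_eq : ∀ t : ℝ, 0 ≤ t → x t = x₀ + ∫ s in (0 : ℝ)..t, (A *ᵥ x s + B *ᵥ u s)

/-- The quadratic cost `∫₀^∞ uᵀ R u + xᵀ Q x dt`, with values in `[0, ∞]`. -/
def lqrCost {n m : ℕ} (Q : Matrix (Fin n) (Fin n) ℝ) (R : Matrix (Fin m) (Fin m) ℝ)
    (x : ℝ → Fin n → ℝ) (u : ℝ → Fin m → ℝ) : ENNReal :=
  ∫⁻ t in Ioi (0 : ℝ), ENNReal.ofReal (u t ⬝ᵥ (R *ᵥ u t) + x t ⬝ᵥ (Q *ᵥ x t))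

/-- `K` is an optimal LQR gain: from every initial state, the closed loop `u = -K x` attains the
minimum of the cost among all trajectories of the system. -/
def IsOptimalGain {n m : ℕ} (A : Matrix (Fin n) (Fin n) ℝ) (B : Matrix (Fin n) (Fin m) ℝ)
    (Q : Matrix (Fin n) (Fin n) ℝ) (R : Matrix (Fin m) (Fin m) ℝ)
    (K : Matrix (Fin m) (Fin n) ℝ) : Prop :=
  ∀ x₀ : Fin n → ℝ, ∃ x : ℝ → Fin n → ℝ,
    IsTrajectory A B x₀ x (fun t => -(K *ᵥ x t)) ∧
    ∀ (y : ℝ → Fin n → ℝ) (v : ℝ → Fin m → ℝ), IsTrajectory A B x₀ y v →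
      lqrCost Q R x (fun t => -(K *ᵥ x t)) ≤ lqrCost Q R y v

/-- The set of the optimal LQR gains of `(A(ρ), B)`, `ρ ∈ S`. -/
def optimalGains {n m p : ℕ} (A : (Fin p → ℝ) → Matrix (Fin n) (Fin n) ℝ)
    (B : Matrix (Fin n) (Fin m) ℝ) (Q : Matrix (Fin n) (Fin n) ℝ)
    (R : Matrix (Fin m) (Fin m) ℝ) (S : Set (Fin p → ℝ)) : Set (Matrix (Fin m) (Fin n) ℝ) :=
  {K | ∃ ρ ∈ S, IsOptimalGain (A ρ) B Q R K}

/-- `P` solves the continuous-time algebraic Riccati equation. -/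
def SolvesCARE {n m : ℕ} (A : Matrix (Fin n) (Fin n) ℝ) (B : Matrix (Fin n) (Fin m) ℝ)
    (Q : Matrix (Fin n) (Fin n) ℝ) (R : Matrix (Fin m) (Fin m) ℝ)
    (P : Matrix (Fin n) (Fin n) ℝ) : Prop :=
  Aᵀ * P + P * A - P * B * R⁻¹ * Bᵀ * P + Q = 0

/-- The triples `(K, P, ρ)` satisfying the CARE at `ρ`, `K = R⁻¹ Bᵀ P`, `ρ ∈ S` and `P ≻ 0`. -/
def feasibleDef {n m p : ℕ} (A : (Fin p → ℝ) → Matrix (Fin n) (Fin n) ℝ)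
    (B : Matrix (Fin n) (Fin m) ℝ) (Q : Matrix (Fin n) (Fin n) ℝ)
    (R : Matrix (Fin m) (Fin m) ℝ) (S : Set (Fin p → ℝ)) :
    Set (Matrix (Fin m) (Fin n) ℝ × Matrix (Fin n) (Fin n) ℝ × (Fin p → ℝ)) :=
  {(K, P, ρ) | SolvesCARE (A ρ) B Q R P ∧ K = R⁻¹ * Bᵀ * P ∧ ρ ∈ S ∧ P.PosDef}

/-- The same feasible set with `P ⪰ 0` in place of `P ≻ 0`. -/
def feasibleSemidef {n m p : ℕ} (A : (Fin p → ℝ) → Matrix (Fin n) (Fin n) ℝ)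
    (B : Matrix (Fin n) (Fin m) ℝ) (Q : Matrix (Fin n) (Fin n) ℝ)
    (R : Matrix (Fin m) (Fin m) ℝ) (S : Set (Fin p → ℝ)) :
    Set (Matrix (Fin m) (Fin n) ℝ × Matrix (Fin n) (Fin n) ℝ × (Fin p → ℝ)) :=
  {(K, P, ρ) | SolvesCARE (A ρ) B Q R P ∧ K = R⁻¹ * Bᵀ * P ∧ ρ ∈ S ∧ P.PosSemidef}

/-- `lo i` and `hi i` are the (attained) minimum and maximum of the `i`-th entry of `vec K` over
the feasible set `F` of triples `(K, P, ρ)`. -/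
def AreOptimalBounds {n m p : ℕ}
    (F : Set (Matrix (Fin m) (Fin n) ℝ × Matrix (Fin n) (Fin n) ℝ × (Fin p → ℝ)))
    (lo hi : Fin n × Fin m → ℝ) : Prop :=
  ∀ i, IsLeast ((fun z => z.1.vec i) '' F) (lo i) ∧
    IsGreatest ((fun z => z.1.vec i) '' F) (hi i)

/-- The hyperrectangle `∏ i, [lo i, hi i]`. -/
def hyperrectangle {n m : ℕ} (lo hi : Fin n × Fin m → ℝ) : Set (Fin n × Fin m → ℝ) :=
  univ.pi fun i => Icc (lo i) (hi i)

end

/-! At each parameter the optimal gain comes from a solution `P ⪰ 0` of the Riccati equation, so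
`vec(𝒦*)` lies in the box as soon as the feasible set is nonempty and compact.

Existence: minimise the trace over the `P ⪰ 0` satisfying the Riccati inequality. Stabilizability
makes this set nonempty, and detectability makes the gain of the minimiser stabilizing. The cost
matrix of that gain satisfies the inequality again and lies below the minimiser, so the two coincide
and equality holds (`exists_posSemidef_solvesCARE`).

Optimality and uniqueness: completing the square writes the cost on `[0, T]` as `x₀ᵀPx₀ -
x(T)ᵀPx(T)` plus the excess `∫ (u+Kx)ᵀR(u+Kx)`. Detectability makes every finite-cost trajectory
square integrable, so the terminal term cannot stay bounded away from zero
(`IsTrajectory.value_add_excess_le`). An optimal feedback therefore has zero excess, which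
determines the gain.

Compactness: a feedback stabilizing at one parameter keeps a common Lyapunov function at nearby
ones, and a multiple of it dominates all solutions `P ⪰ 0` there. A finite cover bounds the trace
over the polytope. Under observability every such `P` is definite, so both feasible sets agree. -/

open Set Matrix MeasureTheory
open scoped MatrixOrder
open Filter Topology

/-! ### Quadratic forms and compactness of trace-bounded semidefinite matrices. -/

section QuadraticForms

variable {n m : ℕ}

theorem dotProduct_mulVec_comm_of_transpose_eq {X : Matrix (Fin n) (Fin n) ℝ} (hX : Xᵀ = X)
    (x y : Fin n → ℝ) : x ⬝ᵥ (X *ᵥ y) = y ⬝ᵥ (X *ᵥ x) := by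
  rw [dotProduct_mulVec, ← mulVec_transpose, hX, dotProduct_comm]

theorem dotProduct_transpose_mulVec (X : Matrix (Fin m) (Fin n) ℝ) (x : Fin n → ℝ)
    (y : Fin m → ℝ) : x ⬝ᵥ (Xᵀ *ᵥ y) = (X *ᵥ x) ⬝ᵥ y := by
  rw [mulVec_transpose, dotProduct_comm, ← dotProduct_mulVec, dotProduct_comm]

theorem Matrix.PosSemidef.transpose_eq {X : Matrix (Fin n) (Fin n) ℝ} (hX : X.PosSemidef) :
    Xᵀ = X := by
  simpa using hX.isHermitian.eq

theorem Matrix.PosSemidef.quadratic_nonneg {X : Matrix (Fin n) (Fin n) ℝ} (hX : X.PosSemidef)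
    (x : Fin n → ℝ) : 0 ≤ x ⬝ᵥ (X *ᵥ x) := by
  simpa using hX.dotProduct_mulVec_nonneg x

theorem Matrix.PosDef.quadratic_pos {X : Matrix (Fin n) (Fin n) ℝ} (hX : X.PosDef)
    {x : Fin n → ℝ} (hx : x ≠ 0) : 0 < x ⬝ᵥ (X *ᵥ x) := by
  simpa using hX.dotProduct_mulVec_pos hx

theorem posSemidef_of_quadratic_nonneg {X : Matrix (Fin n) (Fin n) ℝ} (hX : Xᵀ = X)
    (h : ∀ x, 0 ≤ x ⬝ᵥ (X *ᵥ x)) : X.PosSemidef :=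
  .of_dotProduct_mulVec_nonneg (by simpa [IsHermitian] using hX) (by simpa using h)

theorem posDef_of_quadratic_pos {X : Matrix (Fin n) (Fin n) ℝ} (hX : Xᵀ = X)
    (h : ∀ x, x ≠ 0 → 0 < x ⬝ᵥ (X *ᵥ x)) : X.PosDef :=
  .of_dotProduct_mulVec_pos (by simpa [IsHermitian] using hX) (by simpa using h)

theorem Matrix.PosSemidef.mulVec_eq_zero {X : Matrix (Fin n) (Fin n) ℝ} (hX : X.PosSemidef)
    {x : Fin n → ℝ} (hx : x ⬝ᵥ (X *ᵥ x) = 0) : X *ᵥ x = 0 :=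
  (hX.dotProduct_mulVec_zero_iff x).1 (by simpa using hx)

theorem Matrix.PosDef.eq_zero_of_quadratic {X : Matrix (Fin n) (Fin n) ℝ} (hX : X.PosDef)
    {x : Fin n → ℝ} (hx : x ⬝ᵥ (X *ᵥ x) = 0) : x = 0 := by
  by_contra h
  exact (hX.quadratic_pos h).ne' hx

theorem dotProduct_self_nonneg_real (x : Fin n → ℝ) : 0 ≤ x ⬝ᵥ x :=
  Finset.sum_nonneg fun i _ => mul_self_nonneg (x i)

theorem sq_le_dotProduct_self (x : Fin n → ℝ) (i : Fin n) : x i ^ 2 ≤ x ⬝ᵥ x := by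
  rw [sq]
  exact Finset.single_le_sum (f := fun i => x i * x i) (fun i _ => mul_self_nonneg (x i))
    (Finset.mem_univ i)

/-- A quadratic form is bounded by the sum of the absolute values of its coefficients. -/
theorem abs_quadratic_le (E : Matrix (Fin n) (Fin n) ℝ) (x : Fin n → ℝ) :
    |x ⬝ᵥ (E *ᵥ x)| ≤ (∑ i, ∑ j, |E i j|) * (x ⬝ᵥ x) := by
  have h : x ⬝ᵥ (E *ᵥ x) = ∑ i, ∑ j, E i j * (x i * x j) := by
    simp only [dotProduct, mulVec, Finset.mul_sum]
    exact Finset.sum_congr rfl fun i _ => Finset.sum_congr rfl fun j _ => by ring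
  rw [h, Finset.sum_mul]
  refine (Finset.abs_sum_le_sum_abs _ _).trans (Finset.sum_le_sum fun i _ => ?_)
  rw [Finset.sum_mul]
  refine (Finset.abs_sum_le_sum_abs _ _).trans (Finset.sum_le_sum fun j _ => ?_)
  rw [abs_mul]
  refine mul_le_mul_of_nonneg_left ?_ (abs_nonneg _)
  have hi := sq_le_dotProduct_self x i
  have hj := sq_le_dotProduct_self x j
  rw [abs_le]
  constructor <;> nlinarith [sq_nonneg (x i - x j), sq_nonneg (x i + x j)]

/-- Testing the form on `eᵢ ± eⱼ` gives `2|Pᵢⱼ| ≤ Pᵢᵢ + Pⱼⱼ`. The trace thus serves as a norm on the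
semidefinite cone. -/
theorem Matrix.PosSemidef.abs_apply_le_trace {P : Matrix (Fin n) (Fin n) ℝ} (hP : P.PosSemidef)
    (i j : Fin n) : |P i j| ≤ P.trace := by
  have hd : ∀ k, P k k ≤ P.trace := fun k =>
    Finset.single_le_sum (f := fun k => P k k) (fun k _ => hP.diag_nonneg) (Finset.mem_univ k)
  have hs : P j i = P i j := congrFun (congrFun hP.transpose_eq i) j
  have h1 := hP.quadratic_nonneg (Pi.single i 1 + Pi.single j 1)
  have h2 := hP.quadratic_nonneg (Pi.single i 1 - Pi.single j 1)
  simp only [mulVec_add, mulVec_sub, add_dotProduct, sub_dotProduct, dotProduct_add,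
    dotProduct_sub, mulVec_single_one, single_one_dotProduct, col_apply] at h1 h2
  have hi := hd i
  have hj := hd j
  rw [abs_le]
  constructor <;> linarith

theorem isClosed_setOf_posSemidef : IsClosed {P : Matrix (Fin n) (Fin n) ℝ | P.PosSemidef} := by
  have : {P : Matrix (Fin n) (Fin n) ℝ | P.PosSemidef} =
      {P | Pᵀ = P} ∩ ⋂ x : Fin n → ℝ, {P | 0 ≤ x ⬝ᵥ (P *ᵥ x)} := by
    ext P
    simp only [mem_inter_iff, mem_iInter, mem_ofPred_eq]
    exact ⟨fun h => ⟨h.transpose_eq, h.quadratic_nonneg⟩,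
      fun h => posSemidef_of_quadratic_nonneg h.1 h.2⟩
  rw [this]
  exact (isClosed_eq (by fun_prop) (by fun_prop)).inter
    (isClosed_iInter fun x => isClosed_le (by fun_prop) (by fun_prop))

theorem isCompact_setOf_posSemidef_trace_le (c : ℝ) :
    IsCompact {P : Matrix (Fin n) (Fin n) ℝ | P.PosSemidef ∧ P.trace ≤ c} := by
  have hbox : IsCompact (univ.pi fun _ : Fin n => univ.pi fun _ : Fin n => Icc (-c) c) :=
    isCompact_univ_pi fun _ => isCompact_univ_pi fun _ => isCompact_Icc
  refine IsCompact.of_isClosed_subset hbox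
    (isClosed_setOf_posSemidef.inter (isClosed_le continuous_id.matrix_trace continuous_const))
    fun P hP i _ j _ => ?_
  exact abs_le.1 ((hP.1.abs_apply_le_trace i j).trans hP.2)

theorem eq_zero_of_quadratic_eq_zero {X : Matrix (Fin n) (Fin n) ℝ} (hX : Xᵀ = X)
    (h : ∀ x, x ⬝ᵥ (X *ᵥ x) = 0) : X = 0 := by
  have hp := posSemidef_of_quadratic_nonneg hX fun x => (h x).ge
  ext i j
  have := congrFun (hp.mulVec_eq_zero (h (Pi.single j 1))) i
  simpa using this

theorem Matrix.PosSemidef.eq_of_trace_le {P P' : Matrix (Fin n) (Fin n) ℝ}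
    (h : (P - P').PosSemidef) (ht : P.trace ≤ P'.trace) : P = P' := by
  rw [← sub_eq_zero]
  ext i j
  have h1 := h.abs_apply_le_trace i j
  rw [trace_sub] at h1
  exact abs_nonpos_iff.1 (by linarith)

end QuadraticForms

/-! ### Hurwitz matrices and Lyapunov's theorem by Euler discretisation. -/

section Hurwitz

variable {n : ℕ}

/-- A complex eigenpair of a real matrix, written in real and imaginary parts. -/
theorem mem_spectrum_map_iff {M : Matrix (Fin n) (Fin n) ℝ} {z : ℂ} :
    z ∈ spectrum ℂ (M.map (algebraMap ℝ ℂ)) ↔ ∃ a b : Fin n → ℝ, (a ≠ 0 ∨ b ≠ 0) ∧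
      M *ᵥ a = z.re • a - z.im • b ∧ M *ᵥ b = z.im • a + z.re • b := by
  have hre : ∀ v : Fin n → ℂ, ∀ i, ((M.map (algebraMap ℝ ℂ)) *ᵥ v) i =
      ((M *ᵥ fun j => (v j).re) i : ℂ) + ((M *ᵥ fun j => (v j).im) i : ℂ) * Complex.I := by
    intro v i
    simp only [mulVec, dotProduct, Matrix.map_apply, Complex.coe_algebraMap]
    push_cast
    rw [Finset.sum_mul, ← Finset.sum_add_distrib]
    refine Finset.sum_congr rfl fun j _ => ?_
    conv_lhs => rw [← Complex.re_add_im (v j)]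
    ring
  rw [← Matrix.spectrum_toLin', ← Module.End.hasEigenvalue_iff_mem_spectrum]
  constructor
  · intro h
    obtain ⟨v, hv⟩ := h.exists_hasEigenvector
    have hz := hv.apply_eq_smul
    rw [Matrix.toLin'_apply] at hz
    refine ⟨fun j => (v j).re, fun j => (v j).im, ?_, ?_, ?_⟩
    · by_contra! h0
      apply hv.2
      funext j
      exact Complex.ext (congrFun h0.1 j) (congrFun h0.2 j)
    · funext i
      have h1 := congrArg Complex.re ((hre v i).symm.trans (congrFun hz i))
      simpa using h1
    · funext i
      have h1 := congrArg Complex.im ((hre v i).symm.trans (congrFun hz i))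
      simp at h1
      simp
      linarith
  · rintro ⟨a, b, h0, ha, hb⟩
    have hv : (fun j => (a j : ℂ) + b j * Complex.I) ≠ 0 := by
      intro h
      have h1 : ∀ j, a j = 0 ∧ b j = 0 := fun j => by
        have h2 := congrFun h j
        exact ⟨by simpa using congrArg Complex.re h2, by simpa using congrArg Complex.im h2⟩
      rcases h0 with h0 | h0
      · exact h0 (funext fun j => (h1 j).1)
      · exact h0 (funext fun j => (h1 j).2)
    refine Module.End.hasEigenvalue_of_hasEigenvector (x := fun j => (a j : ℂ) + b j * Complex.I)
      (Module.End.hasEigenvector_iff.2 ⟨Module.End.mem_eigenspace_iff.2 ?_, hv⟩)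
    rw [Matrix.toLin'_apply]
    funext i
    rw [hre]
    simp only [Complex.add_re, Complex.ofReal_re, Complex.mul_re, Complex.I_re, mul_zero,
      Complex.ofReal_im, Complex.I_im, mul_one, sub_self, add_zero, Complex.add_im,
      Complex.mul_im, zero_add]
    have ha' := congrFun ha i
    have hb' := congrFun hb i
    rw [show (fun j => a j) = a from rfl, show (fun j => b j) = b from rfl, ha', hb']
    apply Complex.ext
    · simp
    · simp [add_comm]

theorem isHurwitz_iff {M : Matrix (Fin n) (Fin n) ℝ} :
    IsHurwitz M ↔ ∀ (σ ω : ℝ) (a b : Fin n → ℝ), (a ≠ 0 ∨ b ≠ 0) →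
      M *ᵥ a = σ • a - ω • b → M *ᵥ b = ω • a + σ • b → σ < 0 := by
  constructor
  · intro h σ ω a b h0 ha hb
    exact h ⟨σ, ω⟩ (mem_spectrum_map_iff.2 ⟨a, b, h0, ha, hb⟩)
  · intro h z hz
    obtain ⟨a, b, h0, ha, hb⟩ := mem_spectrum_map_iff.1 hz
    exact h _ _ a b h0 ha hb

/-- By Gelfand's formula `‖a ^ k‖ ^ (1/k)` is eventually below some `r < 1`, so the powers decay
geometrically. -/
theorem tendsto_norm_pow_of_spectralRadius_lt_one {𝔸 : Type*} [NormedRing 𝔸] [NormedAlgebra ℂ 𝔸]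
    [CompleteSpace 𝔸] {a : 𝔸} (ha : spectralRadius ℂ a < 1) :
    Tendsto (fun k : ℕ => ‖a ^ k‖) atTop (𝓝 0) := by
  obtain ⟨r, har, hr⟩ := ENNReal.lt_iff_exists_nnreal_btwn.1 ha
  have hr1 : r < 1 := by exact_mod_cast hr
  have h := (spectrum.pow_nnnorm_pow_one_div_tendsto_nhds_spectralRadius a).eventually_lt_const har
  refine squeeze_zero' (.of_forall fun _ => norm_nonneg _) ?_
    (tendsto_pow_atTop_nhds_zero_of_lt_one r.coe_nonneg (by exact_mod_cast hr1))
  filter_upwards [h, eventually_gt_atTop 0] with k hk hk0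
  have hk' : (‖a ^ k‖₊ : ENNReal) ≤ (r : ENNReal) ^ k := by
    have h1 := ENNReal.rpow_le_rpow hk.le (z := (k : ℝ)) (by positivity)
    rw [← ENNReal.rpow_mul, one_div_mul_cancel (by positivity), ENNReal.rpow_one,
      ENNReal.rpow_natCast] at h1
    exact h1
  have : ‖a ^ k‖₊ ≤ r ^ k := by exact_mod_cast hk'
  exact_mod_cast this

attribute [local instance] Matrix.linftyOpNormedRing Matrix.linftyOpNormedAlgebra in
theorem tendsto_pow_apply_of_spectrum_lt_one {N : Matrix (Fin n) (Fin n) ℂ}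
    (hN : ∀ z ∈ spectrum ℂ N, ‖z‖ < 1) (i j : Fin n) :
    Tendsto (fun k : ℕ => (N ^ k) i j) atTop (𝓝 0) := by
  have : Nonempty (Fin n) := ⟨i⟩
  have hr : spectralRadius ℂ N < 1 := by
    have := spectrum.spectralRadius_lt_of_forall_lt N (r := 1)
      fun z hz => by exact_mod_cast hN z hz
    exact_mod_cast this
  refine squeeze_zero_norm (fun k => ?_) (tendsto_norm_pow_of_spectralRadius_lt_one hr)
  have h1 : ‖(N ^ k) i j‖₊ ≤ ∑ j, ‖(N ^ k) i j‖₊ :=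
    Finset.single_le_sum (f := fun j => ‖(N ^ k) i j‖₊) (fun _ _ => zero_le) (Finset.mem_univ j)
  have h2 : ∑ j, ‖(N ^ k) i j‖₊ ≤ ‖N ^ k‖₊ := by
    rw [Matrix.linfty_opNNNorm_def]
    exact Finset.le_sup (f := fun i => ∑ j, ‖(N ^ k) i j‖₊) (Finset.mem_univ i)
  exact_mod_cast h1.trans h2

/-- A small explicit Euler step of a Hurwitz matrix has all its eigenvalues in the unit disc. -/
theorem IsHurwitz.exists_euler_step {M : Matrix (Fin n) (Fin n) ℝ} (hM : IsHurwitz M) :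
    ∃ h : ℝ, 0 < h ∧ ∀ i j, Tendsto (fun k : ℕ => ((1 + h • M) ^ k) i j) atTop (𝓝 0) := by
  set Mc := M.map (algebraMap ℝ ℂ) with hMc
  have hfin : (spectrum ℂ Mc).Finite := Module.End.finite_spectrum (toLin' Mc) |>.subset
    (by rw [Matrix.spectrum_toLin'])
  -- `‖1 + hz‖² = 1 + h (2 Re z + h ‖z‖²)`, and the bracket is negative for small `h > 0`. The
  -- spectrum is finite, so one `h` serves all eigenvalues.
  have hev : ∀ z ∈ spectrum ℂ Mc, ∀ᶠ h : ℝ in 𝓝[>] 0, ‖1 + (h : ℂ) * z‖ < 1 := by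
    intro z hz
    have hz' := hM z hz
    have h1 : Tendsto (fun h : ℝ => 2 * z.re + h * (z.re ^ 2 + z.im ^ 2)) (𝓝[>] 0)
        (𝓝 (2 * z.re + 0 * (z.re ^ 2 + z.im ^ 2))) :=
      (Continuous.tendsto (by fun_prop) 0).mono_left nhdsWithin_le_nhds
    filter_upwards [h1.eventually_lt_const (by linarith : _ < (0 : ℝ)), self_mem_nhdsWithin]
      with h hh (hpos : 0 < h)
    rw [← sq_lt_one_iff₀ (norm_nonneg _), Complex.sq_norm, Complex.normSq_apply]
    simp only [Complex.add_re, Complex.one_re, Complex.re_ofReal_mul, Complex.add_im,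
      Complex.one_im, Complex.im_ofReal_mul]
    nlinarith [mul_neg_of_pos_of_neg hpos hh]
  obtain ⟨h, hh, hpos⟩ :=
    (((eventually_all_finite hfin).2 hev).and self_mem_nhdsWithin).exists
  refine ⟨h, hpos, fun i j => ?_⟩
  have hpos : (h : ℂ) ≠ 0 := by exact_mod_cast (ne_of_gt hpos)
  have hN : ∀ w ∈ spectrum ℂ (1 + (h : ℂ) • Mc), ‖w‖ < 1 := by
    intro w hw
    have hw' : (w - 1) / h ∈ spectrum ℂ Mc := by
      rw [spectrum.mem_iff] at hw ⊢
      contrapose! hw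
      have : algebraMap ℂ (Matrix (Fin n) (Fin n) ℂ) w - (1 + (h : ℂ) • Mc) =
          (h : ℂ) • (algebraMap ℂ (Matrix (Fin n) (Fin n) ℂ) ((w - 1) / h) - Mc) := by
        simp only [Algebra.algebraMap_eq_smul_one, smul_sub, smul_smul]
        rw [mul_div_cancel₀ _ hpos, sub_smul, one_smul, sub_sub]
      rw [this]
      exact (isUnit_smul_iff (Units.mk0 (h : ℂ) hpos) _).2 hw
    have := hh _ hw'
    rwa [mul_div_cancel₀ _ hpos, add_sub_cancel] at this
  have hmap : ∀ k : ℕ, ((1 + h • M) ^ k).map (algebraMap ℝ ℂ) = (1 + (h : ℂ) • Mc) ^ k := by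
    intro k
    rw [← RingHom.mapMatrix_apply, map_pow, map_add, map_one]
    congr 2
    ext i j
    simp [hMc]
  have h1 := tendsto_pow_apply_of_spectrum_lt_one hN i j
  simp only [← hmap, Matrix.map_apply] at h1
  have h2 := (Complex.continuous_re.tendsto _).comp h1
  simpa [Function.comp_def] using h2

/-- **Lyapunov's theorem**: a Hurwitz matrix has a strict quadratic Lyapunov function. -/
theorem IsHurwitz.exists_lyapunov {M : Matrix (Fin n) (Fin n) ℝ} (hM : IsHurwitz M) :
    ∃ W : Matrix (Fin n) (Fin n) ℝ, W.PosDef ∧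
      ∀ x, x ⬝ᵥ (W *ᵥ (M *ᵥ x)) ≤ -(x ⬝ᵥ x) := by
  obtain ⟨h, hpos, hlim⟩ := hM.exists_euler_step
  set N := 1 + h • M with hN
  have hlim' : Tendsto (fun k : ℕ => ∑ i, ∑ j, |((N ^ k)ᵀ * N ^ k) i j|) atTop (𝓝 0) := by
    have : ∀ i j, Tendsto (fun k : ℕ => |((N ^ k)ᵀ * N ^ k) i j|) atTop (𝓝 0) := by
      intro i j
      simp only [Matrix.mul_apply, Matrix.transpose_apply]
      have := (tendsto_finsetSum Finset.univ fun l _ => (hlim l i).mul (hlim l j)).abs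
      simpa using this
    simpa using tendsto_finsetSum Finset.univ fun i _ =>
      tendsto_finsetSum Finset.univ fun j _ => this i j
  -- `N ^ k` at least halves squared lengths; `k > 0` puts the identity among the summands of `V`
  -- below.
  obtain ⟨k, hk⟩ := (hlim'.eventually_lt_const (by norm_num : (0 : ℝ) < 1 / 2)).and
    (eventually_gt_atTop 0) |>.exists
  have hquad : ∀ (l : ℕ) (x : Fin n → ℝ),
      x ⬝ᵥ (((N ^ l)ᵀ * N ^ l) *ᵥ x) = ((N ^ l) *ᵥ x) ⬝ᵥ ((N ^ l) *ᵥ x) := by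
    intro l x
    rw [← mulVec_mulVec, dotProduct_transpose_mulVec]
  set V := ∑ l ∈ Finset.range k, (N ^ l)ᵀ * N ^ l with hV
  have hVt : Vᵀ = V := by
    simp [hV, transpose_sum, transpose_mul]
  have hVq : ∀ x, x ⬝ᵥ (V *ᵥ x) = ∑ l ∈ Finset.range k, ((N ^ l) *ᵥ x) ⬝ᵥ ((N ^ l) *ᵥ x) := by
    intro x
    rw [hV, sum_mulVec, dotProduct_sum]
    exact Finset.sum_congr rfl fun l _ => hquad l x
  have hVpos : ∀ x, x ⬝ᵥ x ≤ x ⬝ᵥ (V *ᵥ x) := by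
    intro x
    rw [hVq]
    have := Finset.single_le_sum (f := fun l => ((N ^ l) *ᵥ x) ⬝ᵥ ((N ^ l) *ᵥ x))
      (fun l _ => dotProduct_self_nonneg_real _) (Finset.mem_range.2 hk.2)
    simpa using this
  -- One step of `N` telescopes the sum to `|N ^ k x|² - |x|²`.
  have hstep : ∀ x, (N *ᵥ x) ⬝ᵥ (V *ᵥ (N *ᵥ x)) - x ⬝ᵥ (V *ᵥ x) ≤ -(1 / 2) * (x ⬝ᵥ x) := by
    intro x
    have h1 : ∀ l, (N ^ l) *ᵥ (N *ᵥ x) = (N ^ (l + 1)) *ᵥ x := fun l => by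
      rw [mulVec_mulVec, pow_succ]
    rw [hVq, hVq, ← Finset.sum_sub_distrib]
    simp only [h1]
    rw [Finset.sum_range_sub (fun l => ((N ^ l) *ᵥ x) ⬝ᵥ ((N ^ l) *ᵥ x))]
    have h2 := (le_abs_self _).trans (abs_quadratic_le ((N ^ k)ᵀ * N ^ k) x)
    rw [hquad] at h2
    have h3 := mul_le_mul_of_nonneg_right hk.1.le (dotProduct_self_nonneg_real x)
    simp only [pow_zero, one_mulVec]
    linarith
  -- Expanding `N = 1 + hM` in `hstep` and dropping the nonnegative `h²` term leaves `2h xᵀVMx ≤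
  -- -|x|²/2`, hence the factor `4h`.
  refine ⟨(4 * h) • V, ?_, fun x => ?_⟩
  · refine posDef_of_quadratic_pos (by rw [transpose_smul, hVt]) fun x hx => ?_
    rw [smul_mulVec, dotProduct_smul, smul_eq_mul]
    have : 0 < x ⬝ᵥ x := by
      refine (dotProduct_self_nonneg_real x).lt_of_ne' fun h0 => hx (dotProduct_self_eq_zero.1 h0)
    exact mul_pos (by positivity) (this.trans_le (hVpos x))
  · have h1 := hstep x
    have h2 : N *ᵥ x = x + h • (M *ᵥ x) := by
      rw [hN, add_mulVec, one_mulVec, smul_mulVec]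
    have h3 := dotProduct_mulVec_comm_of_transpose_eq hVt x (M *ᵥ x)
    have h4 := (dotProduct_self_nonneg_real _).trans (hVpos (h • (M *ᵥ x)))
    simp only [h2, mulVec_add, mulVec_smul, add_dotProduct, dotProduct_add, smul_dotProduct,
      dotProduct_smul, smul_eq_mul, smul_mulVec] at h1 h4 ⊢
    rw [← h3] at h1
    linarith

end Hurwitz

/-! ### Comparison principle and Lyapunov equation. -/

section Lyapunov

variable {n : ℕ}

theorem isCompact_setOf_dotProduct_self_eq_one :
    IsCompact {x : Fin n → ℝ | x ⬝ᵥ x = 1} := by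
  have hbox : IsCompact (univ.pi fun _ : Fin n => Icc (-1 : ℝ) 1) :=
    isCompact_univ_pi fun _ => isCompact_Icc
  refine hbox.of_isClosed_subset (isClosed_eq (by fun_prop) (by fun_prop)) fun x hx i _ => ?_
  have h := sq_le_dotProduct_self x i
  rw [show x ⬝ᵥ x = 1 from hx] at h
  exact abs_le.1 ((sq_le_one_iff_abs_le_one _).1 h)

/-- If `M` has a strict Lyapunov function and `X` does not increase along `M`, then `X ⪰ 0`. -/
theorem posSemidef_of_strict_lyapunov {M W X : Matrix (Fin n) (Fin n) ℝ} (hW : W.PosDef)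
    (hWM : ∀ x, x ≠ 0 → x ⬝ᵥ (W *ᵥ (M *ᵥ x)) < 0) (hX : Xᵀ = X)
    (hXM : ∀ x, x ⬝ᵥ (X *ᵥ (M *ᵥ x)) ≤ 0) : X.PosSemidef := by
  refine posSemidef_of_quadratic_nonneg hX ?_
  by_contra! hneg
  obtain ⟨x, hx⟩ := hneg
  have hne : ∀ y : Fin n → ℝ, y ⬝ᵥ y = 1 → y ≠ 0 := by
    rintro y hy rfl
    simp at hy
  have hx0 : x ≠ 0 := by
    rintro rfl
    simp at hx
  have hxx : 0 < x ⬝ᵥ x :=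
    (dotProduct_self_nonneg_real x).lt_of_ne' fun h0 => hx0 (dotProduct_self_eq_zero.1 h0)
  have hhom : ∀ (Y : Matrix (Fin n) (Fin n) ℝ) (c : ℝ) (y : Fin n → ℝ),
      (c • y) ⬝ᵥ (Y *ᵥ (c • y)) = c ^ 2 * (y ⬝ᵥ (Y *ᵥ y)) := by
    intro Y c y
    simp only [mulVec_smul, smul_dotProduct, dotProduct_smul, smul_eq_mul]
    ring
  have hunit : ∀ y : Fin n → ℝ, y ≠ 0 →
      ((√(y ⬝ᵥ y))⁻¹ • y) ⬝ᵥ ((√(y ⬝ᵥ y))⁻¹ • y) = 1 := by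
    intro y hy
    have hyy : 0 < y ⬝ᵥ y :=
      (dotProduct_self_nonneg_real y).lt_of_ne' fun h0 => hy (dotProduct_self_eq_zero.1 h0)
    have := hhom 1 (√(y ⬝ᵥ y))⁻¹ y
    simp only [one_mulVec] at this
    rw [this, inv_pow, Real.sq_sqrt hyy.le, inv_mul_cancel₀ hyy.ne']
  obtain ⟨v, hv, hmin⟩ := isCompact_setOf_dotProduct_self_eq_one.exists_isMinOn
    (f := fun y : Fin n → ℝ => (y ⬝ᵥ (X *ᵥ y)) / (y ⬝ᵥ (W *ᵥ y))) ⟨_, hunit x hx0⟩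
    (ContinuousOn.div (by fun_prop) (by fun_prop)
      fun y hy => (hW.quadratic_pos (hne y hy)).ne')
  -- `μ` is the least generalised eigenvalue of `X` relative to `W`. Then `X - μW ⪰ 0` annihilates
  -- `v`, so `vᵀXMv = μ vᵀWMv`; with `μ < 0` the right side would be positive, against `hXM`.
  set μ := (v ⬝ᵥ (X *ᵥ v)) / (v ⬝ᵥ (W *ᵥ v)) with hμ
  have hbound : ∀ y, y ≠ 0 → μ * (y ⬝ᵥ (W *ᵥ y)) ≤ y ⬝ᵥ (X *ᵥ y) := by
    intro y hy
    have h1 := isMinOn_iff.1 hmin _ (hunit y hy)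
    have hyy : 0 < y ⬝ᵥ y :=
      (dotProduct_self_nonneg_real y).lt_of_ne' fun h0 => hy (dotProduct_self_eq_zero.1 h0)
    have h2 : 0 < (√(y ⬝ᵥ y))⁻¹ ^ 2 := by positivity
    simp only [hhom] at h1
    rw [mul_div_mul_left _ _ h2.ne', le_div_iff₀ (hW.quadratic_pos hy)] at h1
    exact h1
  have hWv := hW.quadratic_pos (hne v hv)
  have hμneg : μ < 0 := by
    have h1 := (hbound x hx0).trans_lt hx
    have h2 := hW.quadratic_pos hx0
    by_contra! h3
    exact absurd h1 (not_lt.2 (mul_nonneg h3 h2.le))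
  have hWt := hW.posSemidef.transpose_eq
  have hYt : (X - μ • W)ᵀ = X - μ • W := by
    rw [transpose_sub, transpose_smul, hX, hWt]
  have hYform : ∀ y z, y ⬝ᵥ ((X - μ • W) *ᵥ z) = y ⬝ᵥ (X *ᵥ z) - μ * (y ⬝ᵥ (W *ᵥ z)) := by
    intro y z
    rw [sub_mulVec, smul_mulVec, dotProduct_sub, dotProduct_smul, smul_eq_mul]
  have hY : (X - μ • W).PosSemidef := by
    refine posSemidef_of_quadratic_nonneg hYt fun y => ?_
    rw [hYform]
    by_cases hy : y = 0
    · simp [hy]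
    · linarith [hbound y hy]
  have hYv : (X - μ • W) *ᵥ v = 0 := by
    apply hY.mulVec_eq_zero
    rw [hYform, hμ, div_mul_cancel₀ _ hWv.ne', sub_self]
  have h1 : v ⬝ᵥ ((X - μ • W) *ᵥ (M *ᵥ v)) = 0 := by
    rw [dotProduct_mulVec_comm_of_transpose_eq hYt, hYv, dotProduct_zero]
  rw [hYform] at h1
  nlinarith [hXM v, mul_pos_of_neg_of_neg hμneg (hWM v (hne v hv))]

theorem IsHurwitz.posSemidef {M X : Matrix (Fin n) (Fin n) ℝ} (hM : IsHurwitz M)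
    (hX : Xᵀ = X) (hXM : ∀ x, x ⬝ᵥ (X *ᵥ (M *ᵥ x)) ≤ 0) : X.PosSemidef := by
  obtain ⟨W, hW, hWM⟩ := hM.exists_lyapunov
  refine posSemidef_of_strict_lyapunov hW (fun x hx => (hWM x).trans_lt ?_) hX hXM
  rw [neg_neg_iff_pos]
  exact (dotProduct_self_nonneg_real x).lt_of_ne' fun h0 => hx (dotProduct_self_eq_zero.1 h0)

theorem quadratic_lyapunov_operator {M X : Matrix (Fin n) (Fin n) ℝ} (hX : Xᵀ = X)
    (x : Fin n → ℝ) : x ⬝ᵥ ((Mᵀ * X + X * M) *ᵥ x) = 2 * (x ⬝ᵥ (X *ᵥ (M *ᵥ x))) := by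
  rw [add_mulVec, dotProduct_add, ← mulVec_mulVec, ← mulVec_mulVec, dotProduct_transpose_mulVec,
    dotProduct_mulVec_comm_of_transpose_eq hX (M *ᵥ x) x]
  ring

/-- Solvability of the Lyapunov equation of a Hurwitz matrix. -/
theorem IsHurwitz.exists_lyapunov_eq {M Y : Matrix (Fin n) (Fin n) ℝ} (hM : IsHurwitz M)
    (hY : Yᵀ = Y) : ∃ P : Matrix (Fin n) (Fin n) ℝ, Pᵀ = P ∧ Mᵀ * P + P * M = Y := by
  -- The Lyapunov operator acts on `X + Xᵀ`, and the skew part `X - Xᵀ` is added so that `T` is an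
  -- endomorphism of the whole matrix space. Injectivity then gives surjectivity, and a symmetric
  -- right-hand side forces the skew part to vanish.
  let T : Matrix (Fin n) (Fin n) ℝ →ₗ[ℝ] Matrix (Fin n) (Fin n) ℝ :=
    { toFun := fun X => (Mᵀ * (X + Xᵀ) + (X + Xᵀ) * M) + (X - Xᵀ)
      map_add' := fun X Z => by
        rw [transpose_add]
        noncomm_ring
      map_smul' := fun c X => by
        simp only [transpose_smul, ← smul_add, ← smul_sub, mul_smul_comm, smul_mul_assoc,
          RingHom.id_apply] }
  have hsymm : ∀ X : Matrix (Fin n) (Fin n) ℝ, (X + Xᵀ)ᵀ = X + Xᵀ := fun X => by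
    rw [transpose_add, transpose_transpose, add_comm]
  have hkey : ∀ X Z : Matrix (Fin n) (Fin n) ℝ, Zᵀ = Z → T X = Z →
      X = Xᵀ ∧ Mᵀ * (X + Xᵀ) + (X + Xᵀ) * M = Z := by
    intro X Z hZ hT
    have h1 : (Mᵀ * (X + Xᵀ) + (X + Xᵀ) * M) + (X - Xᵀ) = Z := hT
    have h2 := congrArg transpose h1
    rw [hZ, transpose_add, transpose_sub, transpose_add, transpose_mul, transpose_mul, hsymm,
      transpose_transpose, transpose_transpose] at h2
    have h3 : X - Xᵀ = 0 := by
      have h4 : (2 : ℝ) • (X - Xᵀ) = 0 := by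
        have h5 := congrArg₂ (· - ·) h1 h2
        simp only [sub_self] at h5
        rw [← h5, two_smul]
        abel
      exact (smul_eq_zero.1 h4).resolve_left two_ne_zero
    refine ⟨sub_eq_zero.1 h3, ?_⟩
    rw [h3, add_zero] at h1
    exact h1
  have hinj : Function.Injective T := by
    refine (injective_iff_map_eq_zero T).2 fun X hX => ?_
    obtain ⟨h1, h2⟩ := hkey X 0 transpose_zero hX
    have h3 : ∀ x, x ⬝ᵥ ((X + Xᵀ) *ᵥ (M *ᵥ x)) = 0 := fun x => by
      have := quadratic_lyapunov_operator (M := M) (hsymm X) x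
      rw [h2] at this
      simpa using this.symm
    -- The comparison principle applies to `X + Xᵀ` and to its negative, so the form is zero.
    have h4 := hM.posSemidef (hsymm X) fun x => (h3 x).le
    have h5 := hM.posSemidef (X := -(X + Xᵀ)) (by rw [transpose_neg, hsymm]) fun x => by
      rw [neg_mulVec, dotProduct_neg, h3, neg_zero]
    have h6 : X + Xᵀ = 0 := eq_zero_of_quadratic_eq_zero (hsymm X) fun x => by
      have h7 := h5.quadratic_nonneg x
      rw [neg_mulVec, dotProduct_neg] at h7
      exact le_antisymm (by linarith) (h4.quadratic_nonneg x)
    rw [← h1, ← two_smul ℝ] at h6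
    exact (smul_eq_zero.1 h6).resolve_left two_ne_zero
  obtain ⟨X, hX⟩ := LinearMap.injective_iff_surjective.1 hinj Y
  exact ⟨X + Xᵀ, hsymm X, (hkey X Y hY hX).2⟩

end Lyapunov

/-! ### The algebraic Riccati equation: existence and local bounds. -/

section Riccati

variable {n m : ℕ}

theorem dotProduct_mulVec_input {B : Matrix (Fin n) (Fin m) ℝ} {R : Matrix (Fin m) (Fin m) ℝ}
    {P : Matrix (Fin n) (Fin n) ℝ} {K : Matrix (Fin m) (Fin n) ℝ} (hR : Rᵀ = R) (hP : Pᵀ = P)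
    (hK : R * K = Bᵀ * P) (x : Fin n → ℝ) (y : Fin m → ℝ) :
    x ⬝ᵥ (P *ᵥ (B *ᵥ y)) = (K *ᵥ x) ⬝ᵥ (R *ᵥ y) := by
  rw [dotProduct_mulVec_comm_of_transpose_eq hP, ← dotProduct_transpose_mulVec, mulVec_mulVec,
    ← hK, ← mulVec_mulVec, dotProduct_mulVec_comm_of_transpose_eq hR]

theorem Matrix.PosDef.mul_riccati_gain {R : Matrix (Fin m) (Fin m) ℝ} (hR : R.PosDef)
    (B : Matrix (Fin n) (Fin m) ℝ) (P : Matrix (Fin n) (Fin n) ℝ) :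
    R * (R⁻¹ * Bᵀ * P) = Bᵀ * P := by
  rw [Matrix.mul_assoc, mul_nonsing_inv_cancel_left _ _ ((isUnit_iff_isUnit_det R).1 hR.isUnit)]

/-- The Riccati residual is symmetric, hence determined by its quadratic form. Describing the gain
by `R * K = Bᵀ * P` keeps `R⁻¹` out of later computations. -/
theorem solvesCARE_iff {A : Matrix (Fin n) (Fin n) ℝ} {B : Matrix (Fin n) (Fin m) ℝ}
    {Q : Matrix (Fin n) (Fin n) ℝ} {R : Matrix (Fin m) (Fin m) ℝ} {P : Matrix (Fin n) (Fin n) ℝ}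
    {K : Matrix (Fin m) (Fin n) ℝ} (hR : R.PosDef) (hQ : Qᵀ = Q) (hP : Pᵀ = P)
    (hK : R * K = Bᵀ * P) :
    SolvesCARE A B Q R P ↔ ∀ x, 2 * (x ⬝ᵥ (P *ᵥ (A *ᵥ x))) - (K *ᵥ x) ⬝ᵥ (R *ᵥ (K *ᵥ x)) +
      x ⬝ᵥ (Q *ᵥ x) = 0 := by
  have hRt := hR.posSemidef.transpose_eq
  have hdet := (isUnit_iff_isUnit_det R).1 hR.isUnit
  have hPB : P * B = Kᵀ * R := by
    have := congrArg transpose hK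
    rw [transpose_mul, transpose_mul, transpose_transpose, hRt, hP] at this
    exact this.symm
  have hmat : P * B * R⁻¹ * Bᵀ * P = Kᵀ * (R * K) := by
    rw [hPB, mul_nonsing_inv_cancel_right _ _ hdet, Matrix.mul_assoc, hK]
  have hform : ∀ x, x ⬝ᵥ ((Aᵀ * P + P * A - P * B * R⁻¹ * Bᵀ * P + Q) *ᵥ x) =
      2 * (x ⬝ᵥ (P *ᵥ (A *ᵥ x))) - (K *ᵥ x) ⬝ᵥ (R *ᵥ (K *ᵥ x)) + x ⬝ᵥ (Q *ᵥ x) := by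
    intro x
    rw [hmat, add_mulVec, sub_mulVec, dotProduct_add, dotProduct_sub,
      quadratic_lyapunov_operator hP, ← mulVec_mulVec, dotProduct_transpose_mulVec,
      ← mulVec_mulVec]
  constructor
  · intro h x
    rw [← hform, show _ = _ from h, zero_mulVec, dotProduct_zero]
  · intro h
    refine eq_zero_of_quadratic_eq_zero ?_ fun x => (hform x).trans (h x)
    rw [hmat, transpose_add, transpose_sub, transpose_add, transpose_mul, transpose_mul,
      transpose_mul, transpose_mul, transpose_transpose, transpose_transpose, hQ, hP, hRt,
      Matrix.mul_assoc, add_comm (P * A)]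

/-- Under detectability, the gain of a positive semidefinite solution of the Riccati inequality
is stabilizing. -/
theorem isHurwitz_of_riccati_le {q : ℕ} {A : Matrix (Fin n) (Fin n) ℝ}
    {B : Matrix (Fin n) (Fin m) ℝ} {Q : Matrix (Fin n) (Fin n) ℝ} {R : Matrix (Fin m) (Fin m) ℝ}
    {P : Matrix (Fin n) (Fin n) ℝ} {K : Matrix (Fin m) (Fin n) ℝ} {C : Matrix (Fin q) (Fin n) ℝ}
    (hR : R.PosDef) (hQ : Q.PosSemidef) (hP : P.PosSemidef) (hK : R * K = Bᵀ * P)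
    (hC : ∀ x, x ⬝ᵥ (Q *ᵥ x) = 0 → C *ᵥ x = 0) (hdet : IsDetectable A C)
    (hric : ∀ x, 2 * (x ⬝ᵥ (P *ᵥ (A *ᵥ x))) - (K *ᵥ x) ⬝ᵥ (R *ᵥ (K *ᵥ x)) +
      x ⬝ᵥ (Q *ᵥ x) ≤ 0) : IsHurwitz (A - B * K) := by
  obtain ⟨L, hL⟩ := hdet
  rw [isHurwitz_iff] at hL ⊢
  intro σ ω a b h0 ha hb
  by_contra! hσ
  have hPt := hP.transpose_eq
  have hRt := hR.posSemidef.transpose_eq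
  have hM : ∀ x, x ⬝ᵥ (P *ᵥ ((A - B * K) *ᵥ x)) =
      x ⬝ᵥ (P *ᵥ (A *ᵥ x)) - (K *ᵥ x) ⬝ᵥ (R *ᵥ (K *ᵥ x)) := by
    intro x
    rw [sub_mulVec, mulVec_sub, dotProduct_sub, ← mulVec_mulVec,
      dotProduct_mulVec_input hRt hPt hK]
  have e1 := hM a
  have e2 := hM b
  rw [ha] at e1
  rw [hb] at e2
  simp only [mulVec_add, mulVec_sub, mulVec_smul, dotProduct_add, dotProduct_sub, dotProduct_smul,
    smul_eq_mul] at e1 e2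
  -- For an eigenvector `a + ib` with `σ ≥ 0`, adding the identities at `a` and `b` cancels the `ω`
  -- terms. What remains is a sum of nonnegative terms that is at most zero, so `K` and `C`
  -- annihilate both vectors.
  have hab := dotProduct_mulVec_comm_of_transpose_eq hPt a b
  rw [hab] at e1
  have pa := mul_nonneg hσ (hP.quadratic_nonneg a)
  have pb := mul_nonneg hσ (hP.quadratic_nonneg b)
  have ra := hric a
  have rb := hric b
  have qa := hQ.quadratic_nonneg a
  have qb := hQ.quadratic_nonneg b
  have ka := hR.posSemidef.quadratic_nonneg (K *ᵥ a)
  have kb := hR.posSemidef.quadratic_nonneg (K *ᵥ b)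
  have hKa : K *ᵥ a = 0 := hR.eq_zero_of_quadratic (by linarith)
  have hKb : K *ᵥ b = 0 := hR.eq_zero_of_quadratic (by linarith)
  have hCa : C *ᵥ a = 0 := hC a (by linarith)
  have hCb : C *ᵥ b = 0 := hC b (by linarith)
  -- The pair is then also an eigenpair of the Hurwitz matrix `A - L * C`, a contradiction.
  have hab' : ∀ x, K *ᵥ x = 0 → C *ᵥ x = 0 → (A - L * C) *ᵥ x = (A - B * K) *ᵥ x := by
    intro x h1 h2
    simp only [sub_mulVec, ← mulVec_mulVec, h1, h2, mulVec_zero]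
  exact absurd (hL σ ω a b h0 ((hab' a hKa hCa).trans ha) ((hab' b hKb hCb).trans hb))
    (not_lt.2 hσ)

/-- The cost matrix of a stabilizing feedback. -/
theorem exists_feedback_cost {A : Matrix (Fin n) (Fin n) ℝ} {B : Matrix (Fin n) (Fin m) ℝ}
    {Q : Matrix (Fin n) (Fin n) ℝ} {R : Matrix (Fin m) (Fin m) ℝ} {F : Matrix (Fin m) (Fin n) ℝ}
    (hR : R.PosDef) (hQ : Q.PosSemidef) (hF : IsHurwitz (A - B * F)) :
    ∃ P : Matrix (Fin n) (Fin n) ℝ, P.PosSemidef ∧ ∀ x, 2 * (x ⬝ᵥ (P *ᵥ ((A - B * F) *ᵥ x))) =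
      -(x ⬝ᵥ (Q *ᵥ x)) - (F *ᵥ x) ⬝ᵥ (R *ᵥ (F *ᵥ x)) := by
  obtain ⟨P, hPt, hP⟩ := hF.exists_lyapunov_eq (Y := -Q - Fᵀ * (R * F)) (by
    rw [transpose_sub, transpose_neg, transpose_mul, transpose_mul, transpose_transpose,
      hQ.transpose_eq, hR.posSemidef.transpose_eq, Matrix.mul_assoc])
  have hform : ∀ x, 2 * (x ⬝ᵥ (P *ᵥ ((A - B * F) *ᵥ x))) =
      -(x ⬝ᵥ (Q *ᵥ x)) - (F *ᵥ x) ⬝ᵥ (R *ᵥ (F *ᵥ x)) := by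
    intro x
    rw [← quadratic_lyapunov_operator hPt, hP, sub_mulVec, neg_mulVec, dotProduct_sub,
      dotProduct_neg, ← mulVec_mulVec, dotProduct_transpose_mulVec, ← mulVec_mulVec]
  refine ⟨P, hF.posSemidef hPt fun x => ?_, hform⟩
  have h1 := hQ.quadratic_nonneg x
  have h2 := hR.posSemidef.quadratic_nonneg (F *ᵥ x)
  linarith [hform x]

/-- The left side equals `-((K - F)x)ᵀR((K - F)x)`. -/
theorem riccati_le_of_feedback_cost {A : Matrix (Fin n) (Fin n) ℝ} {B : Matrix (Fin n) (Fin m) ℝ}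
    {Q : Matrix (Fin n) (Fin n) ℝ} {R : Matrix (Fin m) (Fin m) ℝ} {P : Matrix (Fin n) (Fin n) ℝ}
    {F K : Matrix (Fin m) (Fin n) ℝ} (hR : R.PosDef) (hP : Pᵀ = P) (hK : R * K = Bᵀ * P)
    (h : ∀ x, 2 * (x ⬝ᵥ (P *ᵥ ((A - B * F) *ᵥ x))) =
      -(x ⬝ᵥ (Q *ᵥ x)) - (F *ᵥ x) ⬝ᵥ (R *ᵥ (F *ᵥ x))) (x : Fin n → ℝ) :
    2 * (x ⬝ᵥ (P *ᵥ (A *ᵥ x))) - (K *ᵥ x) ⬝ᵥ (R *ᵥ (K *ᵥ x)) + x ⬝ᵥ (Q *ᵥ x) ≤ 0 := by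
  have hRt := hR.posSemidef.transpose_eq
  have h1 := h x
  have h2 := hR.posSemidef.quadratic_nonneg (K *ᵥ x - F *ᵥ x)
  have h3 := dotProduct_mulVec_comm_of_transpose_eq hRt (F *ᵥ x) (K *ᵥ x)
  rw [sub_mulVec, mulVec_sub, dotProduct_sub, ← mulVec_mulVec,
    dotProduct_mulVec_input hRt hP hK] at h1
  rw [mulVec_sub, dotProduct_sub, sub_dotProduct, sub_dotProduct] at h2
  linarith

/-- Existence of a positive semidefinite solution of the algebraic Riccati equation. -/
theorem exists_posSemidef_solvesCARE {q : ℕ} {A : Matrix (Fin n) (Fin n) ℝ}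
    {B : Matrix (Fin n) (Fin m) ℝ} {Q : Matrix (Fin n) (Fin n) ℝ} {R : Matrix (Fin m) (Fin m) ℝ}
    {C : Matrix (Fin q) (Fin n) ℝ} (hR : R.PosDef) (hQ : Q.PosSemidef)
    (hC : ∀ x, x ⬝ᵥ (Q *ᵥ x) = 0 → C *ᵥ x = 0) (hstab : IsStabilizable A B)
    (hdet : IsDetectable A C) :
    ∃ P : Matrix (Fin n) (Fin n) ℝ, P.PosSemidef ∧ SolvesCARE A B Q R P := by
  obtain ⟨F, hF⟩ := hstab
  obtain ⟨P₀, hP₀, hF₀⟩ := exists_feedback_cost hR hQ hF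
  set gain : Matrix (Fin n) (Fin n) ℝ → Matrix (Fin m) (Fin n) ℝ := fun P => R⁻¹ * Bᵀ * P
    with hgain
  have hK : ∀ P, R * gain P = Bᵀ * P := hR.mul_riccati_gain B
  set ric : Set (Matrix (Fin n) (Fin n) ℝ) := ⋂ x : Fin n → ℝ,
    {P | 2 * (x ⬝ᵥ (P *ᵥ (A *ᵥ x))) - (gain P *ᵥ x) ⬝ᵥ (R *ᵥ (gain P *ᵥ x)) +
      x ⬝ᵥ (Q *ᵥ x) ≤ 0} with hric
  have hcl : IsClosed ric := isClosed_iInter fun x => isClosed_le (by fun_prop) continuous_const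
  have hmem : ∀ P, P ∈ ric ↔ ∀ x : Fin n → ℝ, 2 * (x ⬝ᵥ (P *ᵥ (A *ᵥ x))) -
      (gain P *ᵥ x) ⬝ᵥ (R *ᵥ (gain P *ᵥ x)) + x ⬝ᵥ (Q *ᵥ x) ≤ 0 := fun P => by
    simp only [hric, mem_iInter, mem_ofPred_eq]
  -- The cap `P₀.trace` supplies compactness without excluding the candidate `P₀`.
  obtain ⟨P, ⟨⟨hP, hPtr⟩, hPric⟩, hmin⟩ :=
    ((isCompact_setOf_posSemidef_trace_le P₀.trace).inter_right hcl).exists_isMinOn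
      (f := fun P => P.trace) ⟨P₀, ⟨hP₀, le_rfl⟩, (hmem P₀).2
        (riccati_le_of_feedback_cost hR hP₀.transpose_eq (hK P₀) hF₀)⟩
      continuous_id.matrix_trace.continuousOn
  rw [hmem] at hPric
  have hRt := hR.posSemidef.transpose_eq
  have hM := isHurwitz_of_riccati_le hR hQ hP (hK P) hC hdet hPric
  -- Policy improvement: `P'` is the cost matrix of the gain of `P`, and `P' ⪯ P`. Minimality of the
  -- trace forces `P' = P`, turning the inequality into the equation.
  obtain ⟨P', hP', hF'⟩ := exists_feedback_cost hR hQ hM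
  have hle : (P - P').PosSemidef := by
    refine hM.posSemidef (by rw [transpose_sub, hP.transpose_eq, hP'.transpose_eq]) fun x => ?_
    have h1 := hF' x
    have h2 := hPric x
    have h3 : x ⬝ᵥ (P *ᵥ ((A - B * gain P) *ᵥ x)) = x ⬝ᵥ (P *ᵥ (A *ᵥ x)) -
        (gain P *ᵥ x) ⬝ᵥ (R *ᵥ (gain P *ᵥ x)) := by
      rw [sub_mulVec, mulVec_sub, dotProduct_sub, ← mulVec_mulVec,
        dotProduct_mulVec_input hRt hP.transpose_eq (hK P)]
    rw [sub_mulVec, dotProduct_sub]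
    linarith
  have htr : P'.trace ≤ P.trace := by
    have := hle.trace_nonneg
    rw [trace_sub] at this
    linarith
  have heq : P = P' := hle.eq_of_trace_le (isMinOn_iff.1 hmin P' ⟨⟨hP', htr.trans hPtr⟩,
    (hmem P').2 (riccati_le_of_feedback_cost hR hP'.transpose_eq (hK P') hF')⟩)
  refine ⟨P, hP, (solvesCARE_iff hR hQ.transpose_eq hP.transpose_eq (hK P)).2 fun x => ?_⟩
  have h1 := hF' x
  rw [← heq, sub_mulVec, mulVec_sub, dotProduct_sub, ← mulVec_mulVec,
    dotProduct_mulVec_input hRt hP.transpose_eq (hK P)] at h1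
  linarith

/-- The positive semidefinite solutions of the Riccati equation are bounded, locally uniformly in
the system matrix. -/
theorem eventually_trace_le_of_solvesCARE {A₀ : Matrix (Fin n) (Fin n) ℝ}
    {B : Matrix (Fin n) (Fin m) ℝ} {Q : Matrix (Fin n) (Fin n) ℝ} {R : Matrix (Fin m) (Fin m) ℝ}
    (hR : R.PosDef) (hQ : Q.PosSemidef) (hstab : IsStabilizable A₀ B) :
    ∃ c : ℝ, ∀ᶠ A in 𝓝 A₀, ∀ P : Matrix (Fin n) (Fin n) ℝ, P.PosSemidef → SolvesCARE A B Q R P →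
      P.trace ≤ c := by
  obtain ⟨F, hF⟩ := hstab
  obtain ⟨W, hW, hWM⟩ := hF.exists_lyapunov
  set s := ∑ i, ∑ j, |(Q + Fᵀ * (R * F)) i j| with hs
  have hs0 : 0 ≤ s := Finset.sum_nonneg fun i _ => Finset.sum_nonneg fun j _ => abs_nonneg _
  have hsx : ∀ x, x ⬝ᵥ (Q *ᵥ x) + (F *ᵥ x) ⬝ᵥ (R *ᵥ (F *ᵥ x)) ≤ s * (x ⬝ᵥ x) := by
    intro x
    have h1 := (le_abs_self _).trans (abs_quadratic_le (Q + Fᵀ * (R * F)) x)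
    rwa [add_mulVec, dotProduct_add, ← mulVec_mulVec, dotProduct_transpose_mulVec,
      ← mulVec_mulVec] at h1
  have hcont : Continuous fun A : Matrix (Fin n) (Fin n) ℝ => ∑ i, ∑ j, |(W * (A - A₀)) i j| := by
    refine continuous_finsetSum _ fun i _ => continuous_finsetSum _ fun j _ => ?_
    exact (Continuous.matrix_elem (by fun_prop) i j).abs
  -- Perturbing `A₀` costs at most half of the decay of `W`, so `F` and `W` still work near `A₀`.
  have hev := (hcont.tendsto A₀).eventually_lt_const (u := 1 / 2) (by simp)
  refine ⟨(s • W).trace, hev.mono fun A hA P hP hcare => ?_⟩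
  have hpert : ∀ x, x ⬝ᵥ (W *ᵥ ((A - B * F) *ᵥ x)) ≤ -(1 / 2) * (x ⬝ᵥ x) := by
    intro x
    have h1 := (le_abs_self _).trans (abs_quadratic_le (W * (A - A₀)) x)
    have h2 := mul_le_mul_of_nonneg_right hA.le (dotProduct_self_nonneg_real x)
    have h3 : (A - B * F) *ᵥ x = (A₀ - B * F) *ᵥ x + (A - A₀) *ᵥ x := by
      rw [← add_mulVec]
      congr 1
      abel
    rw [h3, mulVec_add, dotProduct_add]
    rw [← mulVec_mulVec] at h1
    linarith [hWM x]
  -- Along `A - B * F` the form of `P` falls at rate at most `xᵀQx + (Fx)ᵀR(Fx) ≤ s|x|²`, while that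
  -- of `s • W` falls at rate at least `s|x|²`.
  have hX : (s • W - P).PosSemidef := by
    refine posSemidef_of_strict_lyapunov hW (M := A - B * F) (fun x hx => ?_) ?_ fun x => ?_
    · have : 0 < x ⬝ᵥ x :=
        (dotProduct_self_nonneg_real x).lt_of_ne' fun h0 => hx (dotProduct_self_eq_zero.1 h0)
      linarith [hpert x]
    · rw [transpose_sub, transpose_smul, hW.posSemidef.transpose_eq, hP.transpose_eq]
    · have hRt := hR.posSemidef.transpose_eq
      have hK := hR.mul_riccati_gain B P
      set K := R⁻¹ * Bᵀ * P
      have h1 := (solvesCARE_iff hR hQ.transpose_eq hP.transpose_eq hK).1 hcare x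
      have h2 := hR.posSemidef.quadratic_nonneg (K *ᵥ x - F *ᵥ x)
      have h3 := dotProduct_mulVec_comm_of_transpose_eq hRt (F *ᵥ x) (K *ᵥ x)
      have h4 : x ⬝ᵥ (P *ᵥ ((A - B * F) *ᵥ x)) = x ⬝ᵥ (P *ᵥ (A *ᵥ x)) -
          (K *ᵥ x) ⬝ᵥ (R *ᵥ (F *ᵥ x)) := by
        rw [sub_mulVec, mulVec_sub, dotProduct_sub, ← mulVec_mulVec,
          dotProduct_mulVec_input hRt hP.transpose_eq hK]
      have h5 := mul_le_mul_of_nonneg_left (hpert x) hs0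
      rw [mulVec_sub, dotProduct_sub, sub_dotProduct, sub_dotProduct] at h2
      rw [sub_mulVec, dotProduct_sub, smul_mulVec, dotProduct_smul, smul_eq_mul]
      linarith [hsx x]
  have := hX.trace_nonneg
  rw [trace_sub] at this
  linarith

end Riccati

/-! ### Energy identities along Carathéodory trajectories. -/

theorem ContinuousLinearMap.intervalIntegrable_comp {E F : Type*} [NormedAddCommGroup E]
    [NormedSpace ℝ E] [NormedAddCommGroup F] [NormedSpace ℝ F] (L : E →L[ℝ] F) {f : ℝ → E}
    {a b : ℝ} (hf : IntervalIntegrable f volume a b) :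
    IntervalIntegrable (fun t => L (f t)) volume a b :=
  ⟨L.integrable_comp hf.1, L.integrable_comp hf.2⟩

/-- The product rule, in integrated form, for primitives of integrable functions. -/
theorem integral_mul_add_mul_of_primitives {f g F G : ℝ → ℝ} {a b : ℝ} (hab : a ≤ b)
    (hf : IntervalIntegrable f volume a b) (hg : IntervalIntegrable g volume a b)
    (hF : ∀ t ∈ Icc a b, F t = F a + ∫ s in a..t, f s)
    (hG : ∀ t ∈ Icc a b, G t = G a + ∫ s in a..t, g s) :
    ∫ t in a..b, (f t * G t + F t * g t) = F b * G b - F a * G a := by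
  -- Inputs are merely integrable, so the product rule is obtained from absolute continuity and
  -- almost-everywhere derivatives.
  have hac : ∀ {h : ℝ → ℝ} (c : ℝ), IntervalIntegrable h volume a b →
      AbsolutelyContinuousOnInterval (fun t => c + ∫ s in a..t, h s) a b := fun {h} c hh =>
    (LipschitzWith.const c).lipschitzOnWith.absolutelyContinuousOnInterval.add
      (hh.absolutelyContinuousOnInterval_intervalIntegral left_mem_uIcc)
  have key := (hac (F a) hf).integral_deriv_mul_eq_sub (hac (G a) hg)
  simp only [← hF b (right_mem_Icc.2 hab), ← hG b (right_mem_Icc.2 hab),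
    intervalIntegral.integral_same, add_zero] at key
  rw [← key]
  apply intervalIntegral.integral_congr_ae
  filter_upwards [hf.ae_hasDerivAt_integral, hg.ae_hasDerivAt_integral] with t h1 h2 ht
  have ht' : t ∈ uIcc a b := uIoc_subset_uIcc ht
  rw [((h1 ht' a left_mem_uIcc).const_add (F a)).deriv,
    ((h2 ht' a left_mem_uIcc).const_add (G a)).deriv, hF t (uIcc_of_le hab ▸ ht'),
    hG t (uIcc_of_le hab ▸ ht')]

section Trajectories

variable {n m : ℕ} {A : Matrix (Fin n) (Fin n) ℝ} {B : Matrix (Fin n) (Fin m) ℝ}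
  {x₀ : Fin n → ℝ} {y : ℝ → Fin n → ℝ} {v : ℝ → Fin m → ℝ}

namespace IsTrajectory

theorem apply_zero (h : IsTrajectory A B x₀ y v) : y 0 = x₀ := by
  simpa using h.integral_eq 0 le_rfl

theorem continuousOn_Icc (h : IsTrajectory A B x₀ y v) (T : ℝ) : ContinuousOn y (Icc 0 T) :=
  h.continuousOn.mono Icc_subset_Ici_self

theorem intervalIntegrable_velocity (h : IsTrajectory A B x₀ y v) {T : ℝ} (hT : 0 ≤ T) :
    IntervalIntegrable (fun s => A *ᵥ y s + B *ᵥ v s) volume 0 T := by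
  refine IntervalIntegrable.add ?_ ?_
  · refine ContinuousOn.intervalIntegrable ?_
    rw [uIcc_of_le hT]
    exact (by fun_prop : Continuous fun x : Fin n → ℝ => A *ᵥ x).comp_continuousOn
      (h.continuousOn_Icc T)
  · exact (LinearMap.toContinuousLinearMap B.mulVecLin).intervalIntegrable_comp
      (h.locallyIntegrable T hT)

/-- The rate of change of the quadratic form `P` along a trajectory is integrable. -/
theorem intervalIntegrable_power (h : IsTrajectory A B x₀ y v) (P : Matrix (Fin n) (Fin n) ℝ)
    {T : ℝ} (hT : 0 ≤ T) :
    IntervalIntegrable (fun t => 2 * (y t ⬝ᵥ (P *ᵥ (A *ᵥ y t + B *ᵥ v t)))) volume 0 T := by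
  have h1 := (LinearMap.toContinuousLinearMap P.mulVecLin).intervalIntegrable_comp
    (h.intervalIntegrable_velocity hT)
  refine IntervalIntegrable.const_mul ?_ 2
  have h2 := IntervalIntegrable.sum Finset.univ fun i (_ : i ∈ Finset.univ) =>
    ((ContinuousLinearMap.proj (R := ℝ) i).intervalIntegrable_comp h1).continuousOn_mul
      (g := fun t => y t i) (by
        rw [uIcc_of_le hT]
        exact (continuous_apply i).comp_continuousOn (h.continuousOn_Icc T))
  refine h2.congr fun t _ => ?_
  simp [dotProduct]

theorem integral_power (h : IsTrajectory A B x₀ y v) {P : Matrix (Fin n) (Fin n) ℝ}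
    (hP : Pᵀ = P) {T : ℝ} (hT : 0 ≤ T) :
    ∫ t in (0 : ℝ)..T, 2 * (y t ⬝ᵥ (P *ᵥ (A *ᵥ y t + B *ᵥ v t))) =
      y T ⬝ᵥ (P *ᵥ y T) - x₀ ⬝ᵥ (P *ᵥ x₀) := by
  set g : ℝ → Fin n → ℝ := fun s => A *ᵥ y s + B *ᵥ v s with hg
  have hgi : ∀ i, ∀ t ∈ Icc 0 T, IntervalIntegrable (fun s => g s i) volume 0 t := fun i t ht =>
    (ContinuousLinearMap.proj (R := ℝ) i).intervalIntegrable_comp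
      (h.intervalIntegrable_velocity ht.1)
  have hy : ∀ i, ∀ t ∈ Icc 0 T, y t i = y 0 i + ∫ s in (0 : ℝ)..t, g s i := by
    intro i t ht
    rw [h.apply_zero, h.integral_eq t ht.1]
    have := ContinuousLinearMap.intervalIntegral_comp_comm
      (ContinuousLinearMap.proj (R := ℝ) (φ := fun _ : Fin n => ℝ) i)
      (h.intervalIntegrable_velocity ht.1)
    simp only [ContinuousLinearMap.proj_apply] at this
    rw [Pi.add_apply, ← this]
  have hyc : ∀ i, ContinuousOn (fun t => y t i) (uIcc 0 T) := fun i => by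
    rw [uIcc_of_le hT]
    exact (continuous_apply i).comp_continuousOn (h.continuousOn_Icc T)
  have hT' : T ∈ Icc 0 T := right_mem_Icc.2 hT
  have hint : ∀ i j, IntervalIntegrable (fun t => P i j * (g t i * y t j + y t i * g t j))
      volume 0 T := fun i j =>
    (((hgi i T hT').mul_continuousOn (hyc j)).add
      ((hgi j T hT').continuousOn_mul (hyc i))).const_mul _
  have hprod : ∀ i j, ∫ t in (0 : ℝ)..T, P i j * (g t i * y t j + y t i * g t j) =
      P i j * (y T i * y T j - y 0 i * y 0 j) := fun i j => by
    rw [intervalIntegral.integral_const_mul,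
      integral_mul_add_mul_of_primitives hT (hgi i T hT') (hgi j T hT') (hy i) (hy j)]
  have hform : ∀ x z : Fin n → ℝ, x ⬝ᵥ (P *ᵥ z) = ∑ i, ∑ j, P i j * (x i * z j) := by
    intro x z
    simp only [dotProduct, mulVec, Finset.mul_sum]
    exact Finset.sum_congr rfl fun i _ => Finset.sum_congr rfl fun j _ => by ring
  have hsum : ∀ t, 2 * (y t ⬝ᵥ (P *ᵥ g t)) =
      ∑ i, ∑ j, P i j * (g t i * y t j + y t i * g t j) := by
    intro t
    rw [two_mul]
    nth_rewrite 1 [dotProduct_mulVec_comm_of_transpose_eq hP]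
    rw [hform, hform, ← Finset.sum_add_distrib]
    refine Finset.sum_congr rfl fun i _ => ?_
    rw [← Finset.sum_add_distrib]
    exact Finset.sum_congr rfl fun j _ => by ring
  change ∫ t in (0 : ℝ)..T, 2 * (y t ⬝ᵥ (P *ᵥ g t)) = _
  simp only [hsum]
  have hint' : ∀ i, IntervalIntegrable (fun t => ∑ j, P i j * (g t i * y t j + y t i * g t j))
      volume 0 T := fun i =>
    (IntervalIntegrable.sum Finset.univ fun j _ => hint i j).congr fun t _ => by simp
  rw [intervalIntegral.integral_finsetSum fun i _ => hint' i]
  rw [hform, hform, ← Finset.sum_sub_distrib, ← h.apply_zero]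
  refine Finset.sum_congr rfl fun i _ => ?_
  rw [intervalIntegral.integral_finsetSum fun j _ => hint i j, ← Finset.sum_sub_distrib]
  refine Finset.sum_congr rfl fun j _ => ?_
  rw [hprod]
  ring

variable {Q : Matrix (Fin n) (Fin n) ℝ} {R : Matrix (Fin m) (Fin m) ℝ}

theorem runningCost_nonneg (hR : R.PosSemidef) (hQ : Q.PosSemidef) (x : Fin n → ℝ)
    (u : Fin m → ℝ) : 0 ≤ u ⬝ᵥ (R *ᵥ u) + x ⬝ᵥ (Q *ᵥ x) :=
  add_nonneg (hR.quadratic_nonneg u) (hQ.quadratic_nonneg x)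

theorem integrableOn_runningCost (h : IsTrajectory A B x₀ y v) (hR : R.PosSemidef)
    (hQ : Q.PosSemidef) (hfin : lqrCost Q R y v ≠ ⊤) {T : ℝ} (hT : 0 ≤ T) :
    IntegrableOn (fun t => v t ⬝ᵥ (R *ᵥ v t) + y t ⬝ᵥ (Q *ᵥ y t)) (Ioc 0 T) := by
  refine ⟨?_, ?_⟩
  · have hv : AEStronglyMeasurable v (volume.restrict (Ioc 0 T)) :=
      (h.locallyIntegrable T hT).1.aestronglyMeasurable
    have hy : AEStronglyMeasurable y (volume.restrict (Ioc 0 T)) :=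
      ((h.continuousOn_Icc T).mono Ioc_subset_Icc_self).aestronglyMeasurable measurableSet_Ioc
    exact ((by fun_prop : Continuous fun u : Fin m → ℝ =>
      u ⬝ᵥ (R *ᵥ u)).comp_aestronglyMeasurable hv).add
      ((by fun_prop : Continuous fun x : Fin n → ℝ =>
        x ⬝ᵥ (Q *ᵥ x)).comp_aestronglyMeasurable hy)
  · rw [hasFiniteIntegral_iff_ofReal (.of_forall fun t => runningCost_nonneg hR hQ _ _)]
    exact (lintegral_mono_set Ioc_subset_Ioi_self).trans_lt (lt_top_iff_ne_top.2 hfin)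

theorem intervalIntegrable_runningCost (h : IsTrajectory A B x₀ y v) (hR : R.PosSemidef)
    (hQ : Q.PosSemidef) (hfin : lqrCost Q R y v ≠ ⊤) {T : ℝ} (hT : 0 ≤ T) :
    IntervalIntegrable (fun t => v t ⬝ᵥ (R *ᵥ v t) + y t ⬝ᵥ (Q *ᵥ y t)) volume 0 T :=
  (intervalIntegrable_iff_integrableOn_Ioc_of_le hT).2 (h.integrableOn_runningCost hR hQ hfin hT)

theorem integral_runningCost_le (h : IsTrajectory A B x₀ y v) (hR : R.PosSemidef)
    (hQ : Q.PosSemidef) (hfin : lqrCost Q R y v ≠ ⊤) {T : ℝ} (hT : 0 ≤ T) :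
    ∫ t in (0 : ℝ)..T, (v t ⬝ᵥ (R *ᵥ v t) + y t ⬝ᵥ (Q *ᵥ y t)) ≤ (lqrCost Q R y v).toReal := by
  rw [intervalIntegral.integral_of_le hT, ← ENNReal.ofReal_le_iff_le_toReal hfin,
    ofReal_integral_eq_lintegral_ofReal (h.integrableOn_runningCost hR hQ hfin hT)
      (.of_forall fun t => runningCost_nonneg hR hQ _ _)]
  exact lintegral_mono_set Ioc_subset_Ioi_self

end IsTrajectory

theorem exists_dotProduct_mulVec_self_le {k l : ℕ} (E : Matrix (Fin k) (Fin l) ℝ) :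
    ∃ c : ℝ, 0 ≤ c ∧ ∀ x, (E *ᵥ x) ⬝ᵥ (E *ᵥ x) ≤ c * (x ⬝ᵥ x) := by
  refine ⟨∑ i, ∑ j, |(Eᵀ * E) i j|,
    Finset.sum_nonneg fun i _ => Finset.sum_nonneg fun j _ => abs_nonneg _, fun x => ?_⟩
  have h1 := (le_abs_self _).trans (abs_quadratic_le (Eᵀ * E) x)
  rwa [← mulVec_mulVec, dotProduct_transpose_mulVec] at h1

theorem matSqrt_mul_self {Q : Matrix (Fin n) (Fin n) ℝ} (hQ : Q.PosSemidef) :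
    matSqrt Q * matSqrt Q = Q :=
  CFC.sqrt_mul_sqrt_self Q (Matrix.nonneg_iff_posSemidef.2 hQ)

theorem quadratic_eq_matSqrt {Q : Matrix (Fin n) (Fin n) ℝ} (hQ : Q.PosSemidef)
    (x : Fin n → ℝ) : x ⬝ᵥ (Q *ᵥ x) = (matSqrt Q *ᵥ x) ⬝ᵥ (matSqrt Q *ᵥ x) := by
  have hs : (matSqrt Q)ᵀ = matSqrt Q :=
    (Matrix.nonneg_iff_posSemidef.1 (CFC.sqrt_nonneg Q)).transpose_eq
  rw [← dotProduct_transpose_mulVec, hs, mulVec_mulVec, matSqrt_mul_self hQ]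

theorem matSqrt_mulVec_eq_zero {Q : Matrix (Fin n) (Fin n) ℝ} (hQ : Q.PosSemidef)
    {x : Fin n → ℝ} (hx : x ⬝ᵥ (Q *ᵥ x) = 0) : matSqrt Q *ᵥ x = 0 := by
  rw [quadratic_eq_matSqrt hQ] at hx
  exact dotProduct_self_eq_zero.1 hx

theorem Matrix.PosDef.exists_dotProduct_self_le {R : Matrix (Fin m) (Fin m) ℝ} (hR : R.PosDef) :
    ∃ c : ℝ, 0 ≤ c ∧ ∀ u, u ⬝ᵥ u ≤ c * (u ⬝ᵥ (R *ᵥ u)) := by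
  obtain ⟨c, hc, h⟩ := exists_dotProduct_mulVec_self_le (R⁻¹ * matSqrt R)
  refine ⟨c, hc, fun u => ?_⟩
  have h1 := h (matSqrt R *ᵥ u)
  rwa [mulVec_mulVec, Matrix.mul_assoc, matSqrt_mul_self hR.posSemidef,
    nonsing_inv_mul _ ((isUnit_iff_isUnit_det R).1 hR.isUnit), one_mulVec,
    ← quadratic_eq_matSqrt hR.posSemidef] at h1

/-- Detectability yields a storage function that bounds the state by the running cost. -/
theorem exists_storage {Q : Matrix (Fin n) (Fin n) ℝ} {R : Matrix (Fin m) (Fin m) ℝ}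
    (B : Matrix (Fin n) (Fin m) ℝ) (hR : R.PosDef) (hQ : Q.PosSemidef)
    (hdet : IsDetectable A (matSqrt Q)) :
    ∃ (W : Matrix (Fin n) (Fin n) ℝ) (c : ℝ), W.PosDef ∧ 0 ≤ c ∧
      ∀ (x : Fin n → ℝ) (u : Fin m → ℝ), 2 * (x ⬝ᵥ (W *ᵥ (A *ᵥ x + B *ᵥ u))) ≤
        -(x ⬝ᵥ x) + c * (u ⬝ᵥ (R *ᵥ u) + x ⬝ᵥ (Q *ᵥ x)) := by
  obtain ⟨L, hL⟩ := hdet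
  obtain ⟨W, hW, hWM⟩ := hL.exists_lyapunov
  obtain ⟨c₁, hc₁, h₁⟩ := exists_dotProduct_mulVec_self_le (W * L)
  obtain ⟨c₂, hc₂, h₂⟩ := exists_dotProduct_mulVec_self_le (W * B)
  obtain ⟨c₃, hc₃, h₃⟩ := hR.exists_dotProduct_self_le
  -- `W` yields `-2|x|²`; the injection term `L C x` and the input term `B u` each give back
  -- `|x|²/2` through `young`, and their remaining squares give the two summands of the constant.
  refine ⟨W, 2 * c₁ + 2 * (c₂ * c₃), hW, by positivity, fun x u => ?_⟩
  have young : ∀ z : Fin n → ℝ, 2 * (x ⬝ᵥ z) ≤ 1 / 2 * (x ⬝ᵥ x) + 2 * (z ⬝ᵥ z) := by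
    intro z
    have h := dotProduct_self_nonneg_real (x - (2 : ℝ) • z)
    simp only [sub_dotProduct, dotProduct_sub, smul_dotProduct, dotProduct_smul,
      smul_eq_mul, dotProduct_comm z x] at h
    linarith
  set C := matSqrt Q
  have hsplit : W *ᵥ (A *ᵥ x + B *ᵥ u) = W *ᵥ ((A - L * C) *ᵥ x) + (W * L) *ᵥ (C *ᵥ x) +
      (W * B) *ᵥ u := by
    simp only [sub_mulVec, mulVec_sub, mulVec_add, ← mulVec_mulVec]
    abel
  rw [hsplit, dotProduct_add, dotProduct_add]
  have y₁ := young ((W * L) *ᵥ (C *ᵥ x))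
  have y₂ := young ((W * B) *ᵥ u)
  have b₁ := h₁ (C *ᵥ x)
  rw [← quadratic_eq_matSqrt hQ] at b₁
  have b₂ := (h₂ u).trans (mul_le_mul_of_nonneg_left (h₃ u) hc₂)
  have q₁ := mul_nonneg hc₁ (hR.posSemidef.quadratic_nonneg u)
  have q₂ := mul_nonneg (mul_nonneg hc₂ hc₃) (hQ.quadratic_nonneg x)
  linarith [hWM x]

end Trajectories

/-! ### Optimality and uniqueness of the Riccati gain; definiteness under observability. -/

section Optimality

variable {n m : ℕ} {A : Matrix (Fin n) (Fin n) ℝ} {B : Matrix (Fin n) (Fin m) ℝ}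
  {Q : Matrix (Fin n) (Fin n) ℝ} {R : Matrix (Fin m) (Fin m) ℝ} {P : Matrix (Fin n) (Fin n) ℝ}
  {K : Matrix (Fin m) (Fin n) ℝ} {x₀ : Fin n → ℝ} {y : ℝ → Fin n → ℝ} {v : ℝ → Fin m → ℝ}

theorem SolvesCARE.completion_of_squares (hcare : SolvesCARE A B Q R P) (hR : R.PosDef)
    (hQ : Qᵀ = Q) (hP : Pᵀ = P) (hK : R * K = Bᵀ * P) (x : Fin n → ℝ) (u : Fin m → ℝ) :
    (u + K *ᵥ x) ⬝ᵥ (R *ᵥ (u + K *ᵥ x)) =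
      (u ⬝ᵥ (R *ᵥ u) + x ⬝ᵥ (Q *ᵥ x)) + 2 * (x ⬝ᵥ (P *ᵥ (A *ᵥ x + B *ᵥ u))) := by
  have hRt := hR.posSemidef.transpose_eq
  have h1 := (solvesCARE_iff hR hQ hP hK).1 hcare x
  have h2 := dotProduct_mulVec_comm_of_transpose_eq hRt u (K *ᵥ x)
  have h3 := dotProduct_mulVec_input hRt hP hK x u
  simp only [mulVec_add, dotProduct_add, add_dotProduct]
  rw [h3]
  linarith

theorem IsTrajectory.cost_identity (h : IsTrajectory A B x₀ y v) (hcare : SolvesCARE A B Q R P)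
    (hR : R.PosDef) (hQ : Q.PosSemidef) (hP : Pᵀ = P) (hK : R * K = Bᵀ * P)
    (hfin : lqrCost Q R y v ≠ ⊤) {T : ℝ} (hT : 0 ≤ T) :
    IntervalIntegrable (fun t => (v t + K *ᵥ y t) ⬝ᵥ (R *ᵥ (v t + K *ᵥ y t))) volume 0 T ∧
    ∫ t in (0 : ℝ)..T, (v t + K *ᵥ y t) ⬝ᵥ (R *ᵥ (v t + K *ᵥ y t)) =
      (∫ t in (0 : ℝ)..T, (v t ⬝ᵥ (R *ᵥ v t) + y t ⬝ᵥ (Q *ᵥ y t))) +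
        (y T ⬝ᵥ (P *ᵥ y T) - x₀ ⬝ᵥ (P *ᵥ x₀)) := by
  simp only [hcare.completion_of_squares hR hQ.transpose_eq hP hK]
  have h1 := h.intervalIntegrable_runningCost hR.posSemidef hQ hfin hT
  have h2 := h.intervalIntegrable_power P hT
  exact ⟨h1.add h2, by rw [intervalIntegral.integral_add h1 h2, h.integral_power hP hT]⟩

/-- The cost of a trajectory is bounded below by the value `x₀ᵀ P x₀` plus the excess caused by the
deviation from the feedback `-K x` on any initial interval. -/
theorem IsTrajectory.value_add_excess_le (h : IsTrajectory A B x₀ y v)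
    (hcare : SolvesCARE A B Q R P) (hR : R.PosDef) (hQ : Q.PosSemidef) (hP : P.PosSemidef)
    (hK : R * K = Bᵀ * P) (hdet : IsDetectable A (matSqrt Q)) (hfin : lqrCost Q R y v ≠ ⊤)
    {T₀ : ℝ} (hT₀ : 0 ≤ T₀) :
    x₀ ⬝ᵥ (P *ᵥ x₀) + ∫ t in (0 : ℝ)..T₀, (v t + K *ᵥ y t) ⬝ᵥ (R *ᵥ (v t + K *ᵥ y t)) ≤
      (lqrCost Q R y v).toReal := by
  set J := (lqrCost Q R y v).toReal with hJ
  set e : ℝ → ℝ := fun t => (v t + K *ᵥ y t) ⬝ᵥ (R *ᵥ (v t + K *ᵥ y t)) with he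
  have he0 : ∀ t, 0 ≤ e t := fun t => hR.posSemidef.quadratic_nonneg _
  by_contra! hlt
  -- If the bound failed by `δ > 0`, the cost identity would give `y(T)ᵀPy(T) ≥ δ` for all `T ≥ T₀`,
  -- keeping `|y|²` away from zero.
  set δ := x₀ ⬝ᵥ (P *ᵥ x₀) + (∫ t in (0 : ℝ)..T₀, e t) - J with hδ
  have hδ0 : 0 < δ := by linarith
  set s := ∑ i, ∑ j, |P i j| with hs
  have hs0 : 0 ≤ s := Finset.sum_nonneg fun i _ => Finset.sum_nonneg fun j _ => abs_nonneg _
  have hcost := fun {T : ℝ} (hT : 0 ≤ T) => h.integral_runningCost_le hR.posSemidef hQ hfin hT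
  have hlow : ∀ T, T₀ ≤ T → δ ≤ s * (y T ⬝ᵥ y T) := by
    intro T hT
    have hT0 := hT₀.trans hT
    obtain ⟨hi, heq⟩ := h.cost_identity hcare hR hQ hP.transpose_eq hK hfin hT0
    have hmono : ∫ t in (0 : ℝ)..T₀, e t ≤ ∫ t in (0 : ℝ)..T, e t :=
      intervalIntegral.integral_mono_interval le_rfl hT₀ hT (.of_forall he0) hi
    have h1 := (le_abs_self _).trans (abs_quadratic_le P (y T))
    have h2 := hcost hT0
    linarith
  obtain ⟨W, c, hW, hc, hdiss⟩ := exists_storage B hR hQ hdet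
  have hyy : ∀ T, ContinuousOn (fun t => y t ⬝ᵥ y t) (Icc 0 T) := fun T =>
    (by fun_prop : Continuous fun x : Fin n → ℝ => x ⬝ᵥ x).comp_continuousOn
      (h.continuousOn_Icc T)
  have hyyi : ∀ a b, 0 ≤ a → a ≤ b →
      IntervalIntegrable (fun t => y t ⬝ᵥ y t) volume a b := fun a b ha hab =>
    ((hyy b).mono (by rw [uIcc_of_le hab]; exact Icc_subset_Icc_left ha)).intervalIntegrable
  -- Integrating the dissipation inequality of the storage function bounds `∫ |y|²` uniformly in
  -- `T`. This suffices for the contradiction; convergence `y(T) → 0` is not needed.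
  have hup : ∀ T, 0 ≤ T → ∫ t in (0 : ℝ)..T, y t ⬝ᵥ y t ≤ x₀ ⬝ᵥ (W *ᵥ x₀) + c * J := by
    intro T hT
    have hq := h.intervalIntegrable_runningCost hR.posSemidef hQ hfin hT
    have h1 := intervalIntegral.integral_mono_on hT (h.intervalIntegrable_power W hT)
      ((hq.const_mul c).sub (hyyi 0 T le_rfl hT)) fun t _ =>
        (hdiss (y t) (v t)).trans_eq (neg_add_eq_sub _ _)
    rw [h.integral_power hW.posSemidef.transpose_eq hT,
      intervalIntegral.integral_sub (hq.const_mul c) (hyyi 0 T le_rfl hT),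
      intervalIntegral.integral_const_mul] at h1
    have h2 := mul_le_mul_of_nonneg_left (hcost hT) hc
    have h3 := hW.posSemidef.quadratic_nonneg (y T)
    linarith
  set D := x₀ ⬝ᵥ (W *ᵥ x₀) + c * J with hD
  have hgrow : ∀ T, T₀ ≤ T → δ * (T - T₀) ≤ s * D := by
    intro T hT
    have hT0 := hT₀.trans hT
    have h1 : ∫ _ in T₀..T, δ ≤ ∫ t in T₀..T, s * (y t ⬝ᵥ y t) :=
      intervalIntegral.integral_mono_on hT intervalIntegrable_const
        ((hyyi T₀ T hT₀ hT).const_mul s) fun t ht => hlow t ht.1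
    rw [intervalIntegral.integral_const, intervalIntegral.integral_const_mul, smul_eq_mul] at h1
    have h2 : ∫ t in T₀..T, y t ⬝ᵥ y t ≤ ∫ t in (0 : ℝ)..T, y t ⬝ᵥ y t :=
      intervalIntegral.integral_mono_interval hT₀ hT le_rfl
        (.of_forall fun t => dotProduct_self_nonneg_real _) (hyyi 0 T le_rfl hT0)
    have h3 := mul_le_mul_of_nonneg_left (h2.trans (hup T hT0)) hs0
    linarith
  have h1 := hgrow (T₀ + (|s * D| + 1) / δ) (by
    have : 0 ≤ (|s * D| + 1) / δ := by positivity
    linarith)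
  rw [add_sub_cancel_left, mul_div_cancel₀ _ hδ0.ne'] at h1
  linarith [le_abs_self (s * D)]

/-- The closed loop of a linear feedback has a trajectory from every initial state. -/
theorem exists_closedLoop_trajectory (A : Matrix (Fin n) (Fin n) ℝ) (B : Matrix (Fin n) (Fin m) ℝ)
    (K : Matrix (Fin m) (Fin n) ℝ) (x₀ : Fin n → ℝ) :
    ∃ x : ℝ → Fin n → ℝ, IsTrajectory A B x₀ x (fun t => -(K *ᵥ x t)) := by
  set M : (Fin n → ℝ) →L[ℝ] (Fin n → ℝ) :=
    LinearMap.toContinuousLinearMap (A - B * K).mulVecLin with hM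
  set x : ℝ → Fin n → ℝ := fun t => NormedSpace.exp (t • M) x₀ with hx
  have hder : ∀ t, HasDerivAt x (M (x t)) t := fun t =>
    ((hasDerivAt_exp_smul_const' (𝕂 := ℝ) M t).clm_apply (hasDerivAt_const t x₀)).congr_deriv
      (by simp [hx])
  have hc : Continuous x := continuous_iff_continuousAt.2 fun t => (hder t).continuousAt
  have hvel : ∀ t, A *ᵥ x t + B *ᵥ (-(K *ᵥ x t)) = M (x t) := fun t => by
    simp [hM, mulVec_neg, sub_eq_add_neg]
  refine ⟨x, hc.continuousOn, fun T _ => ?_, fun t _ => ?_⟩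
  · exact Continuous.intervalIntegrable (by fun_prop) _ _
  · simp only [hvel]
    rw [intervalIntegral.integral_eq_sub_of_hasDerivAt (fun s _ => hder s)
      ((M.continuous.comp hc).intervalIntegrable _ _)]
    simp [hx]

/-- The closed loop of the Riccati gain costs at most `x₀ᵀ P x₀`. -/
theorem IsTrajectory.lqrCost_closedLoop_le (h : IsTrajectory A B x₀ y fun t => -(K *ᵥ y t))
    (hcare : SolvesCARE A B Q R P) (hR : R.PosDef) (hQ : Q.PosSemidef) (hP : P.PosSemidef)
    (hK : R * K = Bᵀ * P) :
    lqrCost Q R y (fun t => -(K *ᵥ y t)) ≤ ENNReal.ofReal (x₀ ⬝ᵥ (P *ᵥ x₀)) := by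
  set q : ℝ → ℝ := fun t => (-(K *ᵥ y t)) ⬝ᵥ (R *ᵥ (-(K *ᵥ y t))) + y t ⬝ᵥ (Q *ᵥ y t) with hq
  have hq0 : ∀ t, 0 ≤ q t := fun t => IsTrajectory.runningCost_nonneg hR.posSemidef hQ _ _
  -- With `u = -Kx` the completed square vanishes, so the running cost is minus the derivative of
  -- `yᵀPy`.
  have hqp : ∀ t, q t = -(2 * (y t ⬝ᵥ (P *ᵥ (A *ᵥ y t + B *ᵥ (-(K *ᵥ y t)))))) := fun t => by
    have h1 := hcare.completion_of_squares hR hQ.transpose_eq hP.transpose_eq hK (y t)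
      (-(K *ᵥ y t))
    rw [neg_add_cancel, zero_dotProduct] at h1
    simp only [hq]
    linarith
  have hint : ∀ k : ℕ, IntervalIntegrable q volume 0 (k : ℝ) := fun k =>
    (h.intervalIntegrable_power P k.cast_nonneg).neg.congr fun t _ => (hqp t).symm
  have hle : ∀ k : ℕ, ∫ t in (0 : ℝ)..k, q t ≤ x₀ ⬝ᵥ (P *ᵥ x₀) := fun k => by
    simp only [hqp]
    rw [intervalIntegral.integral_neg, h.integral_power hP.transpose_eq k.cast_nonneg]
    linarith [hP.quadratic_nonneg (y k)]
  have hion : IntegrableOn q (Ioi 0) :=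
    integrableOn_Ioi_of_intervalIntegral_norm_bounded (x₀ ⬝ᵥ (P *ᵥ x₀)) 0 (fun k => (hint k).1)
      tendsto_natCast_atTop_atTop (.of_forall fun k => by
        simpa only [Real.norm_of_nonneg (hq0 _)] using hle k)
  have hlim := intervalIntegral_tendsto_integral_Ioi 0 hion
    (tendsto_natCast_atTop_atTop (R := ℝ))
  rw [lqrCost, ← ofReal_integral_eq_lintegral_ofReal hion (.of_forall hq0)]
  exact ENNReal.ofReal_le_ofReal (le_of_tendsto' hlim hle)

theorem SolvesCARE.isOptimalGain (hcare : SolvesCARE A B Q R P) (hR : R.PosDef)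
    (hQ : Q.PosSemidef) (hP : P.PosSemidef) (hK : R * K = Bᵀ * P)
    (hdet : IsDetectable A (matSqrt Q)) : IsOptimalGain A B Q R K := by
  intro x₀
  obtain ⟨x, hx⟩ := exists_closedLoop_trajectory A B K x₀
  refine ⟨x, hx, fun y v hy => (hx.lqrCost_closedLoop_le hcare hR hQ hP hK).trans ?_⟩
  by_cases hfin : lqrCost Q R y v = ⊤
  · rw [hfin]
    exact le_top
  · have h1 := hy.value_add_excess_le hcare hR hQ hP hK hdet hfin le_rfl
    rw [intervalIntegral.integral_same, add_zero] at h1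
    exact ENNReal.ofReal_le_of_le_toReal h1

theorem IsOptimalGain.eq_riccati_gain {K' : Matrix (Fin m) (Fin n) ℝ}
    (hopt : IsOptimalGain A B Q R K') (hcare : SolvesCARE A B Q R P) (hR : R.PosDef)
    (hQ : Q.PosSemidef) (hP : P.PosSemidef) (hK : R * K = Bᵀ * P)
    (hdet : IsDetectable A (matSqrt Q)) : K' = K := by
  refine ext_of_mulVec_single fun j => ?_
  generalize (Pi.single j 1 : Fin n → ℝ) = x₀
  obtain ⟨x, hx, hmin⟩ := hopt x₀
  obtain ⟨z, hz⟩ := exists_closedLoop_trajectory A B K x₀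
  have hle := (hmin z _ hz).trans (hz.lqrCost_closedLoop_le hcare hR hQ hP hK)
  have hfin := ne_top_of_le_ne_top ENNReal.ofReal_ne_top hle
  have h1 := hx.value_add_excess_le hcare hR hQ hP hK hdet hfin zero_le_one
  have h2 := ENNReal.toReal_le_of_le_ofReal (hP.quadratic_nonneg x₀) hle
  -- The excess over `[0, 1]` is zero, and its integrand is continuous because the input is a
  -- feedback. It therefore vanishes at time `0`, where the state is the arbitrary `x₀`.
  have h3 : (-(K' *ᵥ x 0) + K *ᵥ x 0) ⬝ᵥ (R *ᵥ (-(K' *ᵥ x 0) + K *ᵥ x 0)) = 0 := by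
    by_contra hne
    have h4 := intervalIntegral.integral_pos
      (f := fun t => (-(K' *ᵥ x t) + K *ᵥ x t) ⬝ᵥ (R *ᵥ (-(K' *ᵥ x t) + K *ᵥ x t))) zero_lt_one
      ((by fun_prop : Continuous fun w : Fin n → ℝ =>
        (-(K' *ᵥ w) + K *ᵥ w) ⬝ᵥ (R *ᵥ (-(K' *ᵥ w) + K *ᵥ w))).comp_continuousOn
          (hx.continuousOn_Icc 1))
      (fun t _ => hR.posSemidef.quadratic_nonneg _)
      ⟨0, left_mem_Icc.2 zero_le_one, (hR.posSemidef.quadratic_nonneg _).lt_of_ne' hne⟩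
    linarith
  have h5 := hR.eq_zero_of_quadratic h3
  rw [hx.apply_zero, neg_add_eq_zero] at h5
  exact h5

/-- The Riccati equation makes `ker P` an `A`-invariant subspace of `ker √Q`, hence unobservable. -/
theorem SolvesCARE.posDef_of_isObservable (hcare : SolvesCARE A B Q R P) (hQ : Q.PosSemidef)
    (hR : R.PosDef) (hP : P.PosSemidef) (hobs : IsObservable A (matSqrt Q)) : P.PosDef := by
  have hK := hR.mul_riccati_gain B P
  set K := R⁻¹ * Bᵀ * P with hKdef
  have hker : ∀ x, P *ᵥ x = 0 → matSqrt Q *ᵥ x = 0 ∧ P *ᵥ (A *ᵥ x) = 0 := by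
    intro x hx
    have hKx : K *ᵥ x = 0 := by rw [hKdef, ← mulVec_mulVec, hx, mulVec_zero]
    have h1 := (solvesCARE_iff hR hQ.transpose_eq hP.transpose_eq hK).1 hcare x
    rw [dotProduct_mulVec_comm_of_transpose_eq hP.transpose_eq, hx, hKx] at h1
    simp only [dotProduct_zero, mulVec_zero, mul_zero, sub_zero, zero_add] at h1
    refine ⟨matSqrt_mulVec_eq_zero hQ h1, ?_⟩
    have h2 : (Aᵀ * P + P * A - P * B * R⁻¹ * Bᵀ * P + Q) *ᵥ x = 0 := by
      rw [show _ = _ from hcare, zero_mulVec]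
    simpa only [add_mulVec, sub_mulVec, ← mulVec_mulVec, hx, mulVec_zero,
      hQ.mulVec_eq_zero h1, zero_add, sub_zero, add_zero] using h2
  refine posDef_of_quadratic_pos hP.transpose_eq fun x hx => ?_
  refine (hP.quadratic_nonneg x).lt_of_ne' fun h0 => hx (hobs x fun k => ?_)
  have hpow : P *ᵥ ((A ^ k) *ᵥ x) = 0 := by
    induction k with
    | zero => simpa using hP.mulVec_eq_zero h0
    | succ k ih =>
      rw [pow_succ', ← mulVec_mulVec]
      exact (hker _ ih).2
  rw [← mulVec_mulVec]
  exact (hker _ hpow).1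

end Optimality

/-! ### Uniform bounds and compactness over the parameter set. -/

section ParameterDependence

variable {n m p : ℕ}

theorem continuous_lpvMatrix (A₀ : Matrix (Fin n) (Fin n) ℝ)
    (A : Fin p → Matrix (Fin n) (Fin n) ℝ) : Continuous (lpvMatrix A₀ A) := by
  unfold lpvMatrix
  fun_prop

theorem exists_trace_le_of_solvesCARE {A : (Fin p → ℝ) → Matrix (Fin n) (Fin n) ℝ}
    {B : Matrix (Fin n) (Fin m) ℝ} {Q : Matrix (Fin n) (Fin n) ℝ} {R : Matrix (Fin m) (Fin m) ℝ}
    {S : Set (Fin p → ℝ)} (hA : Continuous A) (hS : IsCompact S) (hR : R.PosDef)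
    (hQ : Q.PosSemidef) (hstab : ∀ ρ ∈ S, IsStabilizable (A ρ) B) :
    ∃ c : ℝ, ∀ ρ ∈ S, ∀ P : Matrix (Fin n) (Fin n) ℝ, P.PosSemidef → SolvesCARE (A ρ) B Q R P →
      P.trace ≤ c := by
  refine hS.induction_on (p := fun S => ∃ c : ℝ, ∀ ρ ∈ S, ∀ P : Matrix (Fin n) (Fin n) ℝ,
    P.PosSemidef → SolvesCARE (A ρ) B Q R P → P.trace ≤ c) ⟨0, by simp⟩ ?_ ?_ ?_
  · rintro s t hst ⟨c, hc⟩
    exact ⟨c, fun ρ hρ => hc ρ (hst hρ)⟩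
  · rintro s t ⟨c, hc⟩ ⟨d, hd⟩
    refine ⟨max c d, fun ρ hρ P hP hcare => ?_⟩
    rcases hρ with hρ | hρ
    · exact (hc ρ hρ P hP hcare).trans (le_max_left _ _)
    · exact (hd ρ hρ P hP hcare).trans (le_max_right _ _)
  · intro ρ hρ
    obtain ⟨c, hc⟩ := eventually_trace_le_of_solvesCARE hR hQ (hstab ρ hρ)
    exact ⟨_, mem_nhdsWithin_of_mem_nhds ((hA.tendsto ρ).eventually hc), c, fun _ h => h⟩

/-- The Riccati equation is closed in `(P, ρ)`, the uniform trace bound confines `P` to a compact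
set, and the gain is a continuous function of `P`. -/
theorem isCompact_feasibleSemidef {A : (Fin p → ℝ) → Matrix (Fin n) (Fin n) ℝ}
    {B : Matrix (Fin n) (Fin m) ℝ} {Q : Matrix (Fin n) (Fin n) ℝ} {R : Matrix (Fin m) (Fin m) ℝ}
    {S : Set (Fin p → ℝ)} (hA : Continuous A) (hS : IsCompact S) (hR : R.PosDef)
    (hQ : Q.PosSemidef) (hstab : ∀ ρ ∈ S, IsStabilizable (A ρ) B) :
    IsCompact (feasibleSemidef A B Q R S) := by
  obtain ⟨c, hc⟩ := exists_trace_le_of_solvesCARE hA hS hR hQ hstab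
  have hcl : IsClosed {z : Matrix (Fin n) (Fin n) ℝ × (Fin p → ℝ) |
      SolvesCARE (A z.2) B Q R z.1} := by
    unfold SolvesCARE
    exact isClosed_eq (by fun_prop) continuous_const
  have hcomp := (((isCompact_setOf_posSemidef_trace_le (n := n) c).prod hS).inter_right hcl).image
    (f := fun z => (R⁻¹ * Bᵀ * z.1, z.1, z.2)) (by fun_prop)
  convert! hcomp using 1
  ext ⟨K, P, ρ⟩
  constructor
  · rintro ⟨hcare, rfl, hρ, hP⟩
    exact ⟨(P, ρ), ⟨⟨⟨hP, hc ρ hρ P hP hcare⟩, hρ⟩, hcare⟩, rfl⟩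
  · rintro ⟨⟨P', ρ'⟩, ⟨⟨⟨hP, -⟩, hρ⟩, hcare⟩, heq⟩
    obtain ⟨rfl, rfl, rfl⟩ : R⁻¹ * Bᵀ * P' = K ∧ P' = P ∧ ρ' = ρ := by simpa using heq
    exact ⟨hcare, rfl, hρ, hP⟩

theorem exists_areOptimalBounds
    {F : Set (Matrix (Fin m) (Fin n) ℝ × Matrix (Fin n) (Fin n) ℝ × (Fin p → ℝ))}
    (hF : IsCompact F) (hne : F.Nonempty) : ∃ lo hi, AreOptimalBounds F lo hi := by
  have hcomp : ∀ i : Fin n × Fin m, IsCompact ((fun z => z.1.vec i) '' F) := fun i =>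
    hF.image (by unfold Matrix.vec; fun_prop)
  choose lo hlo using fun i => (hcomp i).exists_isLeast (hne.image _)
  choose hi hhi using fun i => (hcomp i).exists_isGreatest (hne.image _)
  exact ⟨lo, hi, fun i => ⟨hlo i, hhi i⟩⟩

theorem AreOptimalBounds.vec_mem_hyperrectangle
    {F : Set (Matrix (Fin m) (Fin n) ℝ × Matrix (Fin n) (Fin n) ℝ × (Fin p → ℝ))}
    {lo hi : Fin n × Fin m → ℝ} (h : AreOptimalBounds F lo hi)
    {z : Matrix (Fin m) (Fin n) ℝ × Matrix (Fin n) (Fin n) ℝ × (Fin p → ℝ)} (hz : z ∈ F) :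
    z.1.vec ∈ hyperrectangle lo hi := fun i _ =>
  ⟨(h i).1.2 ⟨z, hz, rfl⟩, (h i).2.2 ⟨z, hz, rfl⟩⟩

end ParameterDependence

/-! ### The main theorem. -/

theorem mainTheorem7 {n m p : ℕ}
    (A₀ : Matrix (Fin n) (Fin n) ℝ) (A : Fin p → Matrix (Fin n) (Fin n) ℝ)
    (B : Matrix (Fin n) (Fin m) ℝ)
    (Q : Matrix (Fin n) (Fin n) ℝ) (R : Matrix (Fin m) (Fin m) ℝ)
    (S : Set (Fin p → ℝ)) (hS : IsPolytope S) (hne : S.Nonempty)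
    (hR : R.PosDef) (hQ : Q.PosSemidef)
    (hstab : ∀ ρ ∈ S, IsStabilizable (lpvMatrix A₀ A ρ) B)
    (hdet : ∀ ρ ∈ S, IsDetectable (lpvMatrix A₀ A ρ) (matSqrt Q)) :
    (∀ ρ ∈ S, ∃! K : Matrix (Fin m) (Fin n) ℝ, IsOptimalGain (lpvMatrix A₀ A ρ) B Q R K) ∧
    (∃ lo hi : Fin n × Fin m → ℝ,
      AreOptimalBounds (feasibleSemidef (lpvMatrix A₀ A) B Q R S) lo hi ∧
      Matrix.vec '' optimalGains (lpvMatrix A₀ A) B Q R S ⊆ hyperrectangle lo hi) ∧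
    ((∀ ρ ∈ S, IsObservable (lpvMatrix A₀ A ρ) (matSqrt Q)) →
      ∃ lo hi : Fin n × Fin m → ℝ,
        AreOptimalBounds (feasibleDef (lpvMatrix A₀ A) B Q R S) lo hi ∧
        Matrix.vec '' optimalGains (lpvMatrix A₀ A) B Q R S ⊆ hyperrectangle lo hi) := by
  have hScomp : IsCompact S := by
    obtain ⟨V, hV, rfl⟩ := hS
    exact hV.isCompact_convexHull ℝ
  have hsol : ∀ ρ ∈ S, ∃ P : Matrix (Fin n) (Fin n) ℝ, P.PosSemidef ∧
      SolvesCARE (lpvMatrix A₀ A ρ) B Q R P := fun ρ hρ =>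
    exists_posSemidef_solvesCARE hR hQ (fun x => matSqrt_mulVec_eq_zero hQ) (hstab ρ hρ)
      (hdet ρ hρ)
  have hbounds : ∃ lo hi : Fin n × Fin m → ℝ,
      AreOptimalBounds (feasibleSemidef (lpvMatrix A₀ A) B Q R S) lo hi ∧
      Matrix.vec '' optimalGains (lpvMatrix A₀ A) B Q R S ⊆ hyperrectangle lo hi := by
    obtain ⟨ρ₀, hρ₀⟩ := hne
    obtain ⟨P₀, hP₀, hcare₀⟩ := hsol ρ₀ hρ₀
    obtain ⟨lo, hi, hb⟩ := exists_areOptimalBounds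
      (isCompact_feasibleSemidef (continuous_lpvMatrix A₀ A) hScomp hR hQ hstab)
      ⟨(_, P₀, ρ₀), hcare₀, rfl, hρ₀, hP₀⟩
    refine ⟨lo, hi, hb, ?_⟩
    rintro _ ⟨K, ⟨ρ, hρ, hK⟩, rfl⟩
    obtain ⟨P, hP, hcare⟩ := hsol ρ hρ
    -- An optimal gain equals the gain of any semidefinite solution, so `(K, P, ρ)` is feasible;
    -- uniqueness of `P` is not needed.
    have hKP := hK.eq_riccati_gain hcare hR hQ hP (hR.mul_riccati_gain B P) (hdet ρ hρ)
    exact hb.vec_mem_hyperrectangle (z := (K, P, ρ)) ⟨hcare, hKP, hρ, hP⟩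
  refine ⟨fun ρ hρ => ?_, hbounds, fun hobs => ?_⟩
  · obtain ⟨P, hP, hcare⟩ := hsol ρ hρ
    have hK := hR.mul_riccati_gain B P
    exact ⟨_, hcare.isOptimalGain hR hQ hP hK (hdet ρ hρ),
      fun K' hK' => hK'.eq_riccati_gain hcare hR hQ hP hK (hdet ρ hρ)⟩
  · have heq : feasibleDef (lpvMatrix A₀ A) B Q R S =
        feasibleSemidef (lpvMatrix A₀ A) B Q R S := by
      ext ⟨K, P, ρ⟩
      exact ⟨fun ⟨hcare, hK, hρ, hP⟩ => ⟨hcare, hK, hρ, hP.posSemidef⟩,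
        fun ⟨hcare, hK, hρ, hP⟩ =>
          ⟨hcare, hK, hρ, hcare.posDef_of_isObservable hQ hR hP (hobs ρ hρ)⟩⟩
    rw [heq]
    exact hbounds
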